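/- Let $\Lambda$ be a finite $k$-graph with no sources or sinks, i.e. a category $\Lambda$ with a degree functor $d:\Lambda\to\mathbb N^k$ having the factorisation property (if $d(\lambda)=m+n$, then $\lambda=\mu\nu$ for unique $\mu,\nu$ with $d(\mu)=m$, $d(\nu)=n$), such that every $\Lambda^n:=d^{-1}(n)$ is finite and $v\Lambda^n=\{\lambda\in\Lambda^n:r(\lambda)=v\}$ and $\Lambda^nv=\{\lambda\in\Lambda^n:s(\lambda)=v\}$ are nonempty for all vertices $v\in\Lambda^0$ and $n\in\mathbb N^k$. (Here $s$, $r$ are the domain and codomain maps, $v\Lambda w$ is the set of paths with range $v$ and source $w$, and for $C,D\subset\Lambda^0$ we put $C\Lambda D=\bigcup_{v\in C,w\in D}v\Lambda w$, similarly $C\Lambda^{\mathbb Ne_i}D$ for paths with degree in $\mathbb Ne_i$.) Let $A_i$ be the vertex matrices, $A_i(v,w)=|v\Lambda^{e_i}w|$, let $A_{C,i}$ be the $C\times C$ block of $A_i$, and let $\rho$ denote the spectral radius. A square matrix $A$ of nonnegative integers is irreducible if for all indices $v,w$ there is $m\in\mathbb N$ (possibly $0$) with $A^m(v,w)\neq0$.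 A set $H\subset\Lambda^0$ is hereditary if $v\in H$ and $v\Lambda w\ne\emptyset$ imply $w\in H$; then $\Lambda\backslash H=\{\lambda:s(\lambda)\notin H\}$ is again a finite $k$-graph. Let $\mathcal C$ be the set of nontrivial strongly connected components: the equivalence classes of the relation "$v\Lambda w\neq\emptyset$ and $w\Lambda v\ne\emptyset$", other than the classes $\{v\}$ with $v\Lambda v=\{v\}$; it is partially ordered by $C\le D\iff C\Lambda D\neq\emptyset$. Let $r\in(0,\infty)^k$ satisfy $\max_i r_i^{-1}\ln\rho(A_i)=1$, and put $K=\{i:r_i^{-1}\ln\rho(A_i)=1\}$. A component $C\in\mathcal C$ is critical if there is $j\in K$ such that $r_j=\ln\rho(A_{C,j})$ and $A_{C,j}$ is irreducible; critical components of $\Lambda\backslash H$ are defined in the same way, for the same $r$. Let $\mathcal C_{\rm mincrit}$ be the set of minimal elements of the set of critical components. Let $\mathcal TC^*(\Lambda)$ be the Toeplitz algebra, the $C^*$-algebra generated by a universal Toeplitz--Cuntz--Krieger family $\{t_\lambda\}$, that is, a universal family of partial isometries such that the $q_v:=t_v$ $(v\in\Lambda^0)$ are mutually orthogonal projections, $t_\lambda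 t_\mu=t_{\lambda\mu}$ when $s(\lambda)=r(\mu)$, and $t_\lambda^*t_\mu=\sum t_\alpha t_\beta^*$, where the sum is over the pairs $(\alpha,\beta)$ with $\lambda\alpha=\mu\beta$ of degree $d(\lambda)\vee d(\mu)$. Let $\alpha^r$ be the dynamics with $\alpha^r_s(t_\lambda)=e^{is\,r\cdot d(\lambda)}t_\lambda$ for $s\in\mathbb R$. A state $\phi$ is a KMS$_1$ state if $\phi(ab)=\phi(b\,\alpha^r_{i}(a))$ for all analytic elements $a,b$, where $\alpha^r_i(a)$ is the value at $i=\sqrt{-1}$ of the analytic extension of $s\mapsto\alpha^r_s(a)$. Suppose that $\bigcup\{C:C\in\mathcal C\}=\Lambda^0$, that for every $C\in\mathcal C$ all the matrices $A_{C,i}$ are irreducible, and that for all $C,D\in\mathcal C$, if $C\Lambda^{\mathbb Ne_j}D\ne\emptyset$ for some $j$, then $C\Lambda^{\mathbb Ne_i}D\neq\emptyset$ for all $1\le i\le k$. Let $G=\bigcup\{C:C\in\mathcal C_{\rm mincrit}\}$, let $H'$ be the hereditary closure of $G$ (the smallest hereditary set containing $G$), and let $H=H'\backslash G$. Then: 1.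 $H$ is hereditary in $\Lambda$; 2. $\mathcal C_{\rm mincrit}$ is the set of all critical components of $\Lambda\backslash H$; 3. each $C\in\mathcal C_{\rm mincrit}$ is hereditary in $\Lambda\backslash H$; 4. there is a $*$-homomorphism $q:\mathcal TC^*(\Lambda)\to\mathcal TC^*(\Lambda\backslash H)$ with $q(t_\lambda)=t_\lambda$ if $s(\lambda)\notin H$ and $q(t_\lambda)=0$ if $s(\lambda)\in H$, and every KMS$_1$ state $\phi$ of $(\mathcal TC^*(\Lambda),\alpha^r)$ factors through a KMS$_1$ state $\psi$ of $(\mathcal TC^*(\Lambda\backslash H),\alpha^r)$, in the sense that $\phi=\psi\circ q$. -/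

import Mathlib

open scoped ComplexOrder
open CategoryTheory

universe u v

noncomputable section

/-! ### Higher-rank graphs -/

/-- A higher-rank graph of rank `k` (a `k`-graph): a countable category with a degree functor to
the monoid `ℕ^k` that has the factorisation property.  The objects of the category are the vertices;
a morphism `f : w ⟶ x` is a path with source `w` and range `x`, and the product `λμ` of paths
(defined when `s(λ) = r(μ)`) is the categorical composite `μ ≫ λ`. -/
structure HigherRankGraph (k : ℕ) where
  Vertex : Type u
  [cat : Category.{v} Vertex]
  /-- the degree functor -/
  deg : ∀ {w x : Vertex}, (w ⟶ x) → (Fin k → ℕ)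
  deg_id : ∀ x : Vertex, deg (𝟙 x) = 0
  deg_comp : ∀ {w x y : Vertex} (f : w ⟶ x) (g : x ⟶ y), deg (f ≫ g) = deg g + deg f
  /-- the set of all paths is countable -/
  countable : Countable (Σ w x : Vertex, w ⟶ x)
  /-- the factorisation property: if `d(λ) = m + n` then `λ = μν` for unique `μ`, `ν` with
  `d(μ) = m` and `d(ν) = n` -/
  factorisation : ∀ {w x : Vertex} (f : w ⟶ x) (m n : Fin k → ℕ), deg f = m + n →
    ∃! p : (Σ y : Vertex, (y ⟶ x) × (w ⟶ y)),
      deg p.2.1 = m ∧ deg p.2.2 = n ∧ p.2.2 ≫ p.2.1 = f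

namespace HigherRankGraph

attribute [instance] HigherRankGraph.cat

variable {k : ℕ}

/-- The set of all paths of a `k`-graph. -/
structure Path (Λ : HigherRankGraph.{u, v} k) where
  {src : Λ.Vertex}
  {rng : Λ.Vertex}
  hom : src ⟶ rng

/-- The degree of a path. -/
def Path.d {Λ : HigherRankGraph.{u, v} k} (p : Λ.Path) : Fin k → ℕ := Λ.deg p.hom

/-- The vertex `x`, as a path of degree `0`. -/
def vertexPath (Λ : HigherRankGraph.{u, v} k) (x : Λ.Vertex) : Λ.Path := ⟨𝟙 x⟩

/-- A `k`-graph is finite if there are only finitely many paths of each degree. -/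
class IsFinite (Λ : HigherRankGraph.{u, v} k) : Prop where
  finite_paths : ∀ n : Fin k → ℕ, {p : Λ.Path | p.d = n}.Finite

theorem finite_vertex (Λ : HigherRankGraph.{u, v} k) [Λ.IsFinite] : Finite Λ.Vertex := by
  have h := (IsFinite.finite_paths (Λ := Λ) 0).to_subtype
  refine Finite.of_injective
    (fun x : Λ.Vertex => (⟨Λ.vertexPath x, Λ.deg_id x⟩ : {p : Λ.Path | p.d = 0})) ?_
  intro x y hxy
  exact congrArg (fun p : {p : Λ.Path | p.d = 0} => p.1.src) hxy

instance instFintypeVertex (Λ : HigherRankGraph.{u, v} k) [Λ.IsFinite] : Fintype Λ.Vertex :=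
  haveI := Λ.finite_vertex
  Fintype.ofFinite _

/-- `Λ` has no sources and no sinks: `xΛⁿ` and `Λⁿx` are nonempty for every vertex `x` and every
degree `n`. -/
def NoSourcesOrSinks (Λ : HigherRankGraph.{u, v} k) : Prop :=
  ∀ (x : Λ.Vertex) (n : Fin k → ℕ),
    (∃ (w : Λ.Vertex) (f : w ⟶ x), Λ.deg f = n) ∧ (∃ (y : Λ.Vertex) (f : x ⟶ y), Λ.deg f = n)

/-! ### Vertex matrices and spectral radii -/

/-- The vertex matrix `A_i`, with entries `A_i(x, w) = |x Λ^{e_i} w|`. -/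
def vertexMatrix (Λ : HigherRankGraph.{u, v} k) (i : Fin k) :
    Matrix Λ.Vertex Λ.Vertex ℕ :=
  fun x w => Nat.card {f : w ⟶ x // Λ.deg f = Pi.single i 1}

/-- The diagonal block `A_{C,i}` of the vertex matrix `A_i`. -/
def blockMatrix (Λ : HigherRankGraph.{u, v} k) (C : Set Λ.Vertex) (i : Fin k) : Matrix C C ℕ :=
  fun x w => Λ.vertexMatrix i x w

open Classical in
/-- The spectral radius of a square matrix of natural numbers, viewed as a complex matrix. -/
def specRad {ι : Type*} [Finite ι] (A : Matrix ι ι ℕ) : ℝ :=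
  letI := Fintype.ofFinite ι
  (spectralRadius ℂ (A.map (fun n : ℕ => (n : ℂ)))).toReal

open Classical in
/-- A square matrix of natural numbers is irreducible if for all indices `x`, `w` there is `m ∈ ℕ`
with `A^m(x, w) ≠ 0`. -/
def IrreducibleMatrix {ι : Type*} [Finite ι] (A : Matrix ι ι ℕ) : Prop :=
  letI := Fintype.ofFinite ι
  ∀ x w : ι, ∃ m : ℕ, (A ^ m) x w ≠ 0

/-! ### Hereditary sets and strongly connected components -/

/-- `H` is hereditary: `x ∈ H` and `xΛw ≠ ∅` imply `w ∈ H`. -/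
def IsHereditary (Λ : HigherRankGraph.{u, v} k) (H : Set Λ.Vertex) : Prop :=
  ∀ ⦃x w : Λ.Vertex⦄, x ∈ H → Nonempty (w ⟶ x) → w ∈ H

/-- The hereditary closure of `G`: the smallest hereditary set containing `G`. -/
def hereditaryClosure (Λ : HigherRankGraph.{u, v} k) (G : Set Λ.Vertex) : Set Λ.Vertex :=
  ⋂₀ {H | Λ.IsHereditary H ∧ G ⊆ H}

/-- The equivalence relation on vertices: `x ∼ w` if `xΛw ≠ ∅` and `wΛx ≠ ∅`. -/
def StronglyConnected (Λ : HigherRankGraph.{u, v} k) (x w : Λ.Vertex) : Prop :=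
  Nonempty (w ⟶ x) ∧ Nonempty (x ⟶ w)

/-- The set `𝒞` of nontrivial strongly connected components: the equivalence classes of `∼` other
than the trivial ones, which are the classes `{x}` such that `xΛx = {x}`. -/
def components (Λ : HigherRankGraph.{u, v} k) : Set (Set Λ.Vertex) :=
  {C | (∃ x, C = {w | Λ.StronglyConnected x w}) ∧ ¬ ∃ x, C = {x} ∧ ∀ f : x ⟶ x, f = 𝟙 x}

/-- `Λ_C = CΛC` is coordinatewise irreducible: all the matrices `A_{C,i}` are irreducible. -/
def CoordinatewiseIrreducible (Λ : HigherRankGraph.{u, v} k) [Λ.IsFinite]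
    (C : Set Λ.Vertex) : Prop :=
  ∀ i : Fin k, IrreducibleMatrix (Λ.blockMatrix C i)

/-- `CΛ^{ℕ e_i}D ≠ ∅`. -/
def ColourConnected (Λ : HigherRankGraph.{u, v} k) (i : Fin k) (C D : Set Λ.Vertex) : Prop :=
  ∃ x ∈ C, ∃ w ∈ D, ∃ f : w ⟶ x, ∃ n : ℕ, Λ.deg f = n • (Pi.single i 1 : Fin k → ℕ)

/-- `CΛD ≠ ∅`, that is, `C ≤ D`. -/
def ConnectedTo (Λ : HigherRankGraph.{u, v} k) (C D : Set Λ.Vertex) : Prop :=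
  ∃ x ∈ C, ∃ w ∈ D, Nonempty (w ⟶ x)

/-- The normalisation `max {r_i⁻¹ ln ρ(A_i) : 1 ≤ i ≤ k} = 1` of the dynamics. -/
def Normalised (Λ : HigherRankGraph.{u, v} k) [Λ.IsFinite] (r : Fin k → ℝ) : Prop :=
  IsGreatest (Set.range fun i : Fin k => (r i)⁻¹ * Real.log (specRad (Λ.vertexMatrix i))) 1

/-- The set `K = {i : r_i⁻¹ ln ρ(A_i) = 1}`. -/
def criticalColours (Λ : HigherRankGraph.{u, v} k) [Λ.IsFinite] (r : Fin k → ℝ) : Set (Fin k) :=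
  {i | (r i)⁻¹ * Real.log (specRad (Λ.vertexMatrix i)) = 1}

/-- The set `𝒞_crit` of critical components: those `C ∈ 𝒞` for which there is `j ∈ K` such that
`r_j = ln ρ(A_{C,j})` and `A_{C,j}` is irreducible. -/
def critical (Λ : HigherRankGraph.{u, v} k) [Λ.IsFinite] (r : Fin k → ℝ) : Set (Set Λ.Vertex) :=
  haveI := Λ.finite_vertex
  {C | C ∈ Λ.components ∧ ∃ j ∈ Λ.criticalColours r,
    r j = Real.log (specRad (Λ.blockMatrix C j)) ∧ IrreducibleMatrix (Λ.blockMatrix C j)}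

/-- The set `𝒞_mincrit` of critical components that are minimal among the critical components for
the partial order `C ≤ D ↔ CΛD ≠ ∅`. -/
def minCritical (Λ : HigherRankGraph.{u, v} k) [Λ.IsFinite] (r : Fin k → ℝ) :
    Set (Set Λ.Vertex) :=
  {C | C ∈ Λ.critical r ∧ ∀ D ∈ Λ.critical r, Λ.ConnectedTo D C → D = C}

/-- The set `H = H' \ G`, where `G` is the union of the minimal critical components and `H'` is the
hereditary closure of `G`. -/
def redundantSet (Λ : HigherRankGraph.{u, v} k) [Λ.IsFinite] (r : Fin k → ℝ) : Set Λ.Vertex :=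
  Λ.hereditaryClosure (⋃₀ Λ.minCritical r) \ ⋃₀ Λ.minCritical r

/-! ### Removing a hereditary set -/

/-- The category of paths in `Λ` with range and source outside `H`. -/
instance removeCategory (Λ : HigherRankGraph.{u, v} k) (H : Set Λ.Vertex) :
    Category.{v} {x : Λ.Vertex // x ∉ H} where
  Hom w x := w.1 ⟶ x.1
  id x := 𝟙 x.1
  comp f g := f ≫ g

/-- The `k`-graph `Λ \ H = {λ ∈ Λ : s(λ) ∉ H}`, for a hereditary set `H`.  Since `H` is hereditary,
a path whose source is not in `H` has its range outside `H` too. -/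
def remove (Λ : HigherRankGraph.{u, v} k) (H : Set Λ.Vertex) (hH : Λ.IsHereditary H) :
    HigherRankGraph.{u, v} k where
  Vertex := {x : Λ.Vertex // x ∉ H}
  cat := Λ.removeCategory H
  deg {w x} f := Λ.deg (w := w.1) (x := x.1) f
  deg_id x := Λ.deg_id x.1
  deg_comp {w x y} f g := Λ.deg_comp (w := w.1) (x := x.1) (y := y.1) f g
  countable := by
    have := Λ.countable
    refine Function.Injective.countable
      (f := fun p : (Σ w x : {x : Λ.Vertex // x ∉ H}, w ⟶ x) =>
        (⟨p.1.1, p.2.1.1, p.2.2⟩ : Σ w x : Λ.Vertex, w ⟶ x)) ?_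
    rintro ⟨⟨w, hw⟩, ⟨x, hx⟩, f⟩ ⟨⟨w', hw'⟩, ⟨x', hx'⟩, f'⟩ h
    simp only [Sigma.mk.injEq] at h
    obtain ⟨rfl, h⟩ := h
    simp only [heq_eq_eq, Sigma.mk.injEq] at h
    obtain ⟨rfl, h⟩ := h
    obtain rfl := eq_of_heq h
    rfl
  factorisation {w x} f m n h := by
    obtain ⟨⟨y, g, g'⟩, ⟨h1, h2, h3⟩, huniq⟩ :=
      Λ.factorisation (w := w.1) (x := x.1) f m n h
    refine ⟨⟨⟨y, fun hy => w.2 (hH hy ⟨g'⟩)⟩, g, g'⟩, ⟨h1, h2, h3⟩, ?_⟩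
    rintro ⟨⟨y', hy'⟩, e, e'⟩ ⟨h1', h2', h3'⟩
    have := huniq ⟨y', e, e'⟩ ⟨h1', h2', h3'⟩
    simp only [Sigma.mk.injEq] at this
    obtain ⟨rfl, h⟩ := this
    obtain ⟨rfl, rfl⟩ := Prod.mk.inj (eq_of_heq h)
    rfl

/-- The inclusion of the paths of `Λ \ H` in the paths of `Λ`. -/
def removeIncl (Λ : HigherRankGraph.{u, v} k) (H : Set Λ.Vertex) (hH : Λ.IsHereditary H)
    (p : (Λ.remove H hH).Path) : Λ.Path :=
  Path.mk (Λ := Λ) (src := p.src.1) (rng := p.rng.1) p.hom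

theorem removeIncl_injective (Λ : HigherRankGraph.{u, v} k) (H : Set Λ.Vertex)
    (hH : Λ.IsHereditary H) : Function.Injective (Λ.removeIncl H hH) := by
  rintro @⟨⟨w, hw⟩, ⟨x, hx⟩, f⟩ @⟨⟨w', hw'⟩, ⟨x', hx'⟩, f'⟩ h
  simp only [removeIncl] at h
  cases h
  rfl

instance instIsFiniteRemove (Λ : HigherRankGraph.{u, v} k) [Λ.IsFinite] (H : Set Λ.Vertex)
    (hH : Λ.IsHereditary H) : (Λ.remove H hH).IsFinite where
  finite_paths n :=
    Set.Finite.of_finite_image ((IsFinite.finite_paths (Λ := Λ) n).subset (by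
      rintro _ ⟨p, hp, rfl⟩
      exact hp)) (Λ.removeIncl_injective H hH).injOn

/-! ### Toeplitz-Cuntz-Krieger families -/

/-- `IsMinExt λ μ α β` says that `(α, β) ∈ Λ^min(λ, μ)`: the products `λα` and `μβ` are defined,
`λα = μβ`, and the degree of this path is `d(λ) ∨ d(μ)`. -/
inductive IsMinExt (Λ : HigherRankGraph.{u, v} k) : Λ.Path → Λ.Path → Λ.Path → Λ.Path → Prop
  | mk {w x y z : Λ.Vertex} (l : x ⟶ z) (m : y ⟶ z) (a : w ⟶ x) (b : w ⟶ y)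
      (comm : a ≫ l = b ≫ m) (hdeg : Λ.deg (a ≫ l) = Λ.deg l ⊔ Λ.deg m) :
      IsMinExt Λ ⟨l⟩ ⟨m⟩ ⟨a⟩ ⟨b⟩

/-- The set `Λ^min(λ, μ)`. -/
def minExt (Λ : HigherRankGraph.{u, v} k) (l m : Λ.Path) : Set (Λ.Path × Λ.Path) :=
  {p | Λ.IsMinExt l m p.1 p.2}

theorem IsMinExt.deg_eq {Λ : HigherRankGraph.{u, v} k} {l m a b : Λ.Path}
    (h : Λ.IsMinExt l m a b) : l.d + a.d = l.d ⊔ m.d ∧ m.d + b.d = l.d ⊔ m.d := by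
  obtain ⟨l, m, a, b, comm, hdeg⟩ := h
  refine ⟨?_, ?_⟩
  · exact (Λ.deg_comp a l).symm.trans hdeg
  · exact (Λ.deg_comp b m).symm.trans ((congrArg Λ.deg comm).symm.trans hdeg)

theorem minExt_finite (Λ : HigherRankGraph.{u, v} k) [Λ.IsFinite] (l m : Λ.Path) :
    (Λ.minExt l m).Finite := by
  refine ((IsFinite.finite_paths (Λ := Λ) (l.d ⊔ m.d - l.d)).prod
    (IsFinite.finite_paths (Λ := Λ) (l.d ⊔ m.d - m.d))).subset ?_
  rintro ⟨a, b⟩ h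
  obtain ⟨h1, h2⟩ := IsMinExt.deg_eq h
  exact ⟨by simp [← h1], by simp [← h2]⟩

/-- A Toeplitz-Cuntz-Krieger `Λ`-family of partial isometries. -/
structure IsToeplitzFamily (Λ : HigherRankGraph.{u, v} k) {B : Type*} [NonUnitalRing B]
    [StarRing B] (T : Λ.Path → B) : Prop where
  partial_isometry : ∀ l, T l * star (T l) * T l = T l
  /-- (T1) the vertices give projections ... -/
  projection : ∀ x, IsStarProjection (T (Λ.vertexPath x))
  /-- ... that are mutually orthogonal. -/
  orthogonal : ∀ x y, x ≠ y → T (Λ.vertexPath x) * T (Λ.vertexPath y) = 0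
  /-- (T2) `T_λ T_μ = T_{λμ}` whenever `s(λ) = r(μ)` -/
  mul : ∀ {w x y : Λ.Vertex} (l : x ⟶ y) (m : w ⟶ x), T ⟨l⟩ * T ⟨m⟩ = T ⟨m ≫ l⟩
  /-- (T3) `T_λ* T_μ = ∑ T_α T_β*` over `(α, β) ∈ Λ^min(λ, μ)` -/
  toeplitz : ∀ l m, star (T l) * T m = ∑ᶠ p ∈ Λ.minExt l m, T p.1 * star (T p.2)

/-- A Toeplitz-Cuntz-Krieger `Λ`-family in a unital algebra that is nondegenerate, meaning that
`∑_x T_x = 1`.  Since `T_λ = T_{r(λ)} T_λ = T_λ T_{s(λ)}` and there are finitely many vertices, the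
projection `P = ∑_x T_x` is an identity for the algebra generated by the `T_λ`, so every
Toeplitz-Cuntz-Krieger family in a C*-algebra `B` is one of this kind in the unital C*-algebra
`PBP`. -/
structure IsUnitalToeplitzFamily (Λ : HigherRankGraph.{u, v} k) [Λ.IsFinite] {B : Type*} [Ring B]
    [StarRing B] (T : Λ.Path → B) : Prop extends Λ.IsToeplitzFamily T where
  sum_eq_one : ∑ x, T (Λ.vertexPath x) = 1

/-! ### The free *-algebra on the paths -/

/-- The letters `λ` (tag `false`) and `λ*` (tag `true`). -/
abbrev Letter (Λ : HigherRankGraph.{u, v} k) : Type (max u v) := Λ.Path × Bool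

/-- The free unital complex algebra on the symbols `λ`, `λ*` for `λ` a path of `Λ`; with the
conjugate-linear involution below it is the free unital *-algebra on the paths. -/
def FreeStarAlg (Λ : HigherRankGraph.{u, v} k) : Type (max u v) :=
  MonoidAlgebra ℂ (FreeMonoid Λ.Letter)

namespace FreeStarAlg

variable {Λ : HigherRankGraph.{u, v} k}

instance : Ring Λ.FreeStarAlg := inferInstanceAs (Ring (MonoidAlgebra ℂ (FreeMonoid Λ.Letter)))

instance : Algebra ℂ Λ.FreeStarAlg :=
  inferInstanceAs (Algebra ℂ (MonoidAlgebra ℂ (FreeMonoid Λ.Letter)))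

/-- The generator corresponding to a letter. -/
def gen (a : Λ.Letter) : Λ.FreeStarAlg := MonoidAlgebra.single (FreeMonoid.of a) 1

theorem induction {motive : Λ.FreeStarAlg → Prop}
    (scalar : ∀ c : ℂ, motive (algebraMap ℂ _ c)) (gen : ∀ a, motive (gen a))
    (add : ∀ x y, motive x → motive y → motive (x + y))
    (mul : ∀ x y, motive x → motive y → motive (x * y)) (x : Λ.FreeStarAlg) : motive x := by
  have hword : ∀ m : FreeMonoid Λ.Letter,
      motive (MonoidAlgebra.single m (1 : ℂ) : MonoidAlgebra ℂ (FreeMonoid Λ.Letter)) := by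
    intro m
    induction m using FreeMonoid.inductionOn with
    | one =>
      have := scalar 1
      rw [map_one] at this
      exact this
    | of a => exact gen a
    | mul x y hx hy =>
      have e : (MonoidAlgebra.single (x * y) (1 : ℂ) : MonoidAlgebra ℂ (FreeMonoid Λ.Letter)) =
        MonoidAlgebra.single x 1 * MonoidAlgebra.single y 1 := by
        simp [MonoidAlgebra.single_mul_single]
      rw [e]
      exact mul _ _ hx hy
  refine MonoidAlgebra.induction_linear (motive := motive) x ?_ add ?_
  · have := scalar 0
    rw [map_zero] at this
    exact this
  intro m c
  have e : (MonoidAlgebra.single m c : MonoidAlgebra ℂ (FreeMonoid Λ.Letter)) =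
      algebraMap ℂ (MonoidAlgebra ℂ (FreeMonoid Λ.Letter)) c * MonoidAlgebra.single m 1 := by
    simp [MonoidAlgebra.single_mul_single]
  rw [e]
  exact mul _ _ (scalar c) (hword m)

/-- The conjugate-linear anti-multiplicative map with `λ ↦ λ*` and `λ* ↦ λ`. -/
def starHom : Λ.FreeStarAlg →+* Λ.FreeStarAlgᵐᵒᵖ :=
  MonoidAlgebra.liftNCRingHom (k := ℂ) (G := FreeMonoid Λ.Letter) (R := Λ.FreeStarAlgᵐᵒᵖ)
    ((algebraMap ℂ Λ.FreeStarAlgᵐᵒᵖ).comp (starRingEnd ℂ))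
    (FreeMonoid.lift fun a => MulOpposite.op (gen (a.1, !a.2)))
    (fun c _ => Algebra.commutes (A := Λ.FreeStarAlgᵐᵒᵖ) (star c) _)

theorem starHom_gen (a : Λ.Letter) : starHom (gen a) = MulOpposite.op (gen (a.1, !a.2)) := by
  refine (MonoidAlgebra.liftNCRingHom_single _ _ _ _ _).trans ?_
  simp

theorem starHom_algebraMap (c : ℂ) :
    starHom (algebraMap ℂ Λ.FreeStarAlg c) = algebraMap ℂ Λ.FreeStarAlgᵐᵒᵖ (star c) := by
  refine (MonoidAlgebra.liftNCRingHom_single _ _ _ _ _).trans ?_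
  simp

instance : StarRing Λ.FreeStarAlg where
  star x := (starHom x).unop
  star_involutive x := by
    induction x using FreeStarAlg.induction with
    | scalar c => simp [starHom_algebraMap]
    | gen a => simp [starHom_gen]
    | add x y hx hy => simp_all
    | mul x y hx hy => simp_all
  star_mul x y := by simp
  star_add x y := by simp

theorem star_gen (a : Λ.Letter) : star (gen a) = gen (a.1, !a.2) :=
  congrArg MulOpposite.unop (starHom_gen a)

theorem star_algebraMap (c : ℂ) :
    star (algebraMap ℂ Λ.FreeStarAlg c) = algebraMap ℂ Λ.FreeStarAlg (star c) :=
  congrArg MulOpposite.unop (starHom_algebraMap c)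

instance : StarModule ℂ Λ.FreeStarAlg where
  star_smul c x := by
    rw [Algebra.smul_def, star_mul, star_algebraMap, Algebra.smul_def, Algebra.commutes]

variable {B : Type*} [Ring B] [StarRing B] [Algebra ℂ B]

/-- Evaluation at a family `T`: the unital homomorphism with `λ ↦ T_λ` and `λ* ↦ T_λ*`. -/
def eval (T : Λ.Path → B) : Λ.FreeStarAlg →ₐ[ℂ] B :=
  MonoidAlgebra.lift ℂ B (FreeMonoid Λ.Letter)
    (FreeMonoid.lift fun a => if a.2 then star (T a.1) else T a.1)

theorem eval_gen (T : Λ.Path → B) (a : Λ.Letter) :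
    eval T (gen a) = if a.2 then star (T a.1) else T a.1 := by
  refine (MonoidAlgebra.lift_single _ _ _).trans ?_
  simp

theorem eval_star [StarModule ℂ B] (T : Λ.Path → B) (x : Λ.FreeStarAlg) :
    eval T (star x) = star (eval T x) := by
  induction x using FreeStarAlg.induction with
  | scalar c => rw [star_algebraMap, AlgHom.commutes, AlgHom.commutes, algebraMap_star_comm]
  | gen a => obtain ⟨l, b⟩ := a; cases b <;> simp [star_gen, eval_gen]
  | add x y hx hy => simp_all
  | mul x y hx hy => simp_all

end FreeStarAlg

/-! ### The Toeplitz algebra -/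

section Norm

variable (Λ : HigherRankGraph.{u, v} k) [Λ.IsFinite]

/-- The norms of the images of `x` under all nondegenerate Toeplitz-Cuntz-Krieger `Λ`-families in
C*-algebras. -/
def repNorms (x : Λ.FreeStarAlg) : Set ℝ :=
  {c | ∃ (B : Type (max u v)) (_ : CStarAlgebra B) (T : Λ.Path → B),
    Λ.IsUnitalToeplitzFamily T ∧ c = ‖FreeStarAlg.eval T x‖}

variable {Λ}

theorem IsToeplitzFamily.norm_le_one {B : Type*} [NonUnitalCStarAlgebra B] {T : Λ.Path → B}
    (hT : Λ.IsToeplitzFamily T) (l : Λ.Path) : ‖T l‖ ≤ 1 := by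
  have h1 : ‖T l‖ * ‖T l‖ = ‖star (T l) * T l‖ := CStarRing.norm_star_mul_self.symm
  have h2 : ‖star (T l) * T l‖ * ‖star (T l) * T l‖ = ‖star (T l) * T l‖ := by
    rw [← CStarRing.norm_star_mul_self]
    congr 1
    rw [star_mul, star_star, mul_assoc, ← mul_assoc (T l), hT.partial_isometry]
  rw [← h1] at h2
  by_contra! h
  have h3 : 1 < ‖T l‖ * ‖T l‖ := by nlinarith
  nlinarith

theorem repNorms_bddAbove (x : Λ.FreeStarAlg) : BddAbove (Λ.repNorms x) := by
  suffices h : ∃ c : ℝ, ∀ (B : Type (max u v)) [CStarAlgebra B] (T : Λ.Path → B),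
      Λ.IsUnitalToeplitzFamily T → ‖FreeStarAlg.eval T x‖ ≤ c by
    obtain ⟨c, hc⟩ := h
    refine ⟨c, ?_⟩
    rintro _ ⟨B, _, T, hT, rfl⟩
    exact hc B T hT
  induction x using FreeStarAlg.induction with
  | scalar c =>
    refine ⟨‖c‖, fun B _ T hT => ?_⟩
    rw [AlgHom.commutes]
    rcases subsingleton_or_nontrivial B with h | h
    · rw [Subsingleton.elim (algebraMap ℂ B c) 0, norm_zero]
      exact norm_nonneg _
    · exact (norm_algebraMap' B c).le
  | gen a =>
    refine ⟨1, fun B _ T hT => ?_⟩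
    rw [FreeStarAlg.eval_gen]
    split
    · rw [norm_star]
      exact hT.norm_le_one _
    · exact hT.norm_le_one _
  | add x y hx hy =>
    obtain ⟨c, hc⟩ := hx
    obtain ⟨c', hc'⟩ := hy
    refine ⟨c + c', fun B _ T hT => ?_⟩
    rw [map_add]
    exact norm_add_le_of_le (hc B T hT) (hc' B T hT)
  | mul x y hx hy =>
    obtain ⟨c, hc⟩ := hx
    obtain ⟨c', hc'⟩ := hy
    refine ⟨c * c', fun B _ T hT => ?_⟩
    rw [map_mul]
    exact norm_mul_le_of_le (hc B T hT) (hc' B T hT)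

variable (Λ) in
/-- The universal C*-seminorm: the supremum of `‖eval T x‖` over all nondegenerate
Toeplitz-Cuntz-Krieger `Λ`-families `T` in C*-algebras. -/
def universalNorm (x : Λ.FreeStarAlg) : ℝ := sSup (Λ.repNorms x)

theorem norm_eval_le_universalNorm {B : Type (max u v)} [CStarAlgebra B] {T : Λ.Path → B}
    (hT : Λ.IsUnitalToeplitzFamily T) (x : Λ.FreeStarAlg) :
    ‖FreeStarAlg.eval T x‖ ≤ Λ.universalNorm x :=
  le_csSup (repNorms_bddAbove x) ⟨B, _, T, hT, rfl⟩

theorem universalNorm_nonneg (x : Λ.FreeStarAlg) : 0 ≤ Λ.universalNorm x := by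
  refine Real.sSup_nonneg ?_
  rintro _ ⟨B, _, T, hT, rfl⟩
  exact norm_nonneg _

theorem universalNorm_le {x : Λ.FreeStarAlg} {c : ℝ} (hc : 0 ≤ c)
    (h : ∀ (B : Type (max u v)) [CStarAlgebra B] (T : Λ.Path → B),
      Λ.IsUnitalToeplitzFamily T → ‖FreeStarAlg.eval T x‖ ≤ c) : Λ.universalNorm x ≤ c := by
  refine Real.sSup_le ?_ hc
  rintro _ ⟨B, _, T, hT, rfl⟩
  exact h B T hT

instance : SeminormedRing Λ.FreeStarAlg :=
  { (inferInstance : Ring Λ.FreeStarAlg),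
    AddGroupSeminorm.toSeminormedAddCommGroup
      { toFun := Λ.universalNorm
        map_zero' := le_antisymm (universalNorm_le le_rfl fun B _ T _ => by simp)
          (universalNorm_nonneg _)
        add_le' := fun x y => universalNorm_le
          (add_nonneg (universalNorm_nonneg _) (universalNorm_nonneg _)) fun B _ T hT => by
            rw [map_add]
            exact norm_add_le_of_le (norm_eval_le_universalNorm hT _)
              (norm_eval_le_universalNorm hT _)
        neg' := fun x => by simp [universalNorm, repNorms] } with
    norm_mul_le := fun x y => universalNorm_le
      (mul_nonneg (universalNorm_nonneg _) (universalNorm_nonneg _)) fun B _ T hT => by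
        rw [map_mul]
        exact norm_mul_le_of_le (norm_eval_le_universalNorm hT _)
          (norm_eval_le_universalNorm hT _) }

theorem norm_def (x : Λ.FreeStarAlg) : ‖x‖ = Λ.universalNorm x := rfl

instance : NormedAlgebra ℂ Λ.FreeStarAlg where
  norm_smul_le c x := universalNorm_le (mul_nonneg (norm_nonneg _) (universalNorm_nonneg _))
    fun B _ T hT => by
      rw [map_smul, norm_smul]
      exact mul_le_mul_of_nonneg_left (norm_eval_le_universalNorm hT _) (norm_nonneg _)

theorem norm_star_freeStarAlg (x : Λ.FreeStarAlg) : ‖star x‖ = ‖x‖ := by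
  simp only [norm_def, universalNorm, repNorms]
  congr 1
  ext c
  constructor <;> rintro ⟨B, _, T, hT, rfl⟩ <;>
    exact ⟨B, _, T, hT, by rw [FreeStarAlg.eval_star, norm_star]⟩

theorem norm_mul_self_le_freeStarAlg (x : Λ.FreeStarAlg) : ‖x‖ * ‖x‖ ≤ ‖star x * x‖ := by
  have h : ‖x‖ ≤ √‖star x * x‖ := by
    refine universalNorm_le (Real.sqrt_nonneg _) fun B _ T hT => Real.le_sqrt_of_sq_le ?_
    rw [sq, ← CStarRing.norm_star_mul_self, ← FreeStarAlg.eval_star, ← map_mul]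
    exact norm_eval_le_universalNorm hT _
  calc ‖x‖ * ‖x‖ ≤ √‖star x * x‖ * √‖star x * x‖ := by gcongr
    _ = ‖star x * x‖ := Real.mul_self_sqrt (norm_nonneg _)

end Norm

/-- The Toeplitz algebra `𝒯C*(Λ)`, the C*-algebra generated by a universal Toeplitz-Cuntz-Krieger
`Λ`-family: the (separated) completion of the free *-algebra on the paths in the universal
C*-seminorm. -/
def ToeplitzAlgebra (Λ : HigherRankGraph.{u, v} k) [Λ.IsFinite] : Type (max u v) :=
  UniformSpace.Completion Λ.FreeStarAlg

namespace ToeplitzAlgebra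

open UniformSpace

variable {Λ : HigherRankGraph.{u, v} k} [Λ.IsFinite]

instance : NormedRing Λ.ToeplitzAlgebra := inferInstanceAs (NormedRing (Completion Λ.FreeStarAlg))

instance : CompleteSpace Λ.ToeplitzAlgebra :=
  inferInstanceAs (CompleteSpace (Completion Λ.FreeStarAlg))

instance : Algebra ℂ Λ.ToeplitzAlgebra :=
  inferInstanceAs (Algebra ℂ (Completion Λ.FreeStarAlg))

/-- The canonical map from the free *-algebra. -/
def of : Λ.FreeStarAlg →ₐ[ℂ] Λ.ToeplitzAlgebra :=
  { (Completion.coeRingHom : Λ.FreeStarAlg →+* Completion Λ.FreeStarAlg) with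
    commutes' := fun _ => rfl }

theorem norm_of (x : Λ.FreeStarAlg) : ‖of x‖ = ‖x‖ := Completion.norm_coe x

theorem isometry_of : Isometry (of (Λ := Λ)) := Completion.coe_isometry

theorem denseRange_of : DenseRange (of (Λ := Λ)) := Completion.denseRange_coe

theorem induction_on {motive : Λ.ToeplitzAlgebra → Prop} (a : Λ.ToeplitzAlgebra)
    (hc : IsClosed {a | motive a}) (ih : ∀ x, motive (of x)) : motive a :=
  Completion.induction_on a hc ih

instance : NormedAlgebra ℂ Λ.ToeplitzAlgebra where
  norm_smul_le c a := by
    rw [Algebra.smul_def]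
    refine (norm_mul_le _ _).trans (mul_le_mul_of_nonneg_right ?_ (norm_nonneg _))
    rw [← AlgHom.commutes of, norm_of]
    refine universalNorm_le (norm_nonneg _) fun B _ T hT => ?_
    rw [AlgHom.commutes]
    rcases subsingleton_or_nontrivial B with h | h
    · rw [Subsingleton.elim (algebraMap ℂ B c) 0, norm_zero]
      exact norm_nonneg _
    · exact (norm_algebraMap' B c).le

theorem uniformContinuous_star : UniformContinuous (star : Λ.FreeStarAlg → Λ.FreeStarAlg) := by
  refine Isometry.uniformContinuous (Isometry.of_dist_eq fun x y => ?_)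
  rw [dist_eq_norm, dist_eq_norm, ← star_sub, norm_star_freeStarAlg]

instance : Star Λ.ToeplitzAlgebra where
  star := Completion.map (star : Λ.FreeStarAlg → Λ.FreeStarAlg)

theorem star_of (x : Λ.FreeStarAlg) : star (of x) = of (star x) :=
  Completion.map_coe uniformContinuous_star x

theorem continuous_star' : Continuous (star : Λ.ToeplitzAlgebra → Λ.ToeplitzAlgebra) :=
  Completion.continuous_map

instance : ContinuousStar Λ.ToeplitzAlgebra := ⟨continuous_star'⟩

instance : StarRing Λ.ToeplitzAlgebra where
  star_involutive a := by
    induction a using ToeplitzAlgebra.induction_on with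
    | hc => exact isClosed_eq (by fun_prop) (by fun_prop)
    | ih x =>
    rw [star_of, star_of, star_star]
  star_mul a b := by
    induction a using ToeplitzAlgebra.induction_on with
    | hc => exact isClosed_eq (by fun_prop) (by fun_prop)
    | ih x =>
    induction b using ToeplitzAlgebra.induction_on with
    | hc => exact isClosed_eq (by fun_prop) (by fun_prop)
    | ih y =>
    rw [← map_mul, star_of, star_of, star_of, star_mul, map_mul]
  star_add a b := by
    induction a using ToeplitzAlgebra.induction_on with
    | hc => exact isClosed_eq (by fun_prop) (by fun_prop)
    | ih x =>
    induction b using ToeplitzAlgebra.induction_on with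
    | hc => exact isClosed_eq (by fun_prop) (by fun_prop)
    | ih y =>
    rw [← map_add, star_of, star_of, star_of, star_add, map_add]

instance : CStarRing Λ.ToeplitzAlgebra where
  norm_mul_self_le a := by
    induction a using ToeplitzAlgebra.induction_on with
    | hc => exact isClosed_le (by fun_prop) (by fun_prop)
    | ih x =>
    rw [star_of, ← map_mul, norm_of, norm_of]
    exact norm_mul_self_le_freeStarAlg x

instance : StarModule ℂ Λ.ToeplitzAlgebra where
  star_smul c a := by
    have h : star (algebraMap ℂ Λ.ToeplitzAlgebra c) = algebraMap ℂ Λ.ToeplitzAlgebra (star c) := by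
      rw [← AlgHom.commutes of, star_of, FreeStarAlg.star_algebraMap, AlgHom.commutes]
    rw [Algebra.smul_def, star_mul, h, Algebra.smul_def, Algebra.commutes]

instance : CStarAlgebra Λ.ToeplitzAlgebra where

/-- The universal Toeplitz-Cuntz-Krieger family `{t_λ}`. -/
def t (l : Λ.Path) : Λ.ToeplitzAlgebra := of (FreeStarAlg.gen (l, false))

theorem star_t (l : Λ.Path) : star (t l) = of (FreeStarAlg.gen (l, true)) := by
  rw [t, star_of, FreeStarAlg.star_gen]
  rfl

theorem of_eq_of {x y : Λ.FreeStarAlg}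
    (h : ∀ (B : Type (max u v)) [CStarAlgebra B] (T : Λ.Path → B),
      Λ.IsUnitalToeplitzFamily T → FreeStarAlg.eval T x = FreeStarAlg.eval T y) :
    of x = of y := by
  rw [← sub_eq_zero, ← map_sub, ← norm_eq_zero, norm_of]
  refine le_antisymm (universalNorm_le le_rfl fun B _ T hT => ?_) (norm_nonneg _)
  rw [map_sub, h B T hT, sub_self, norm_zero]

/-- The generators of the Toeplitz algebra form a Toeplitz-Cuntz-Krieger family. -/
theorem isUnitalToeplitzFamily_t : Λ.IsUnitalToeplitzFamily (t (Λ := Λ)) where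
  partial_isometry l := by
    rw [star_t]
    simp only [t, ← map_mul]
    refine of_eq_of fun B _ T hT => ?_
    simpa [FreeStarAlg.eval_gen] using hT.partial_isometry l
  projection x := by
    constructor
    · change _ * _ = _
      simp only [t, ← map_mul]
      refine of_eq_of fun B _ T hT => ?_
      simpa [FreeStarAlg.eval_gen] using (hT.projection x).isIdempotentElem.eq
    · change star _ = _
      rw [star_t, t]
      refine of_eq_of fun B _ T hT => ?_
      simpa [FreeStarAlg.eval_gen] using (hT.projection x).isSelfAdjoint.star_eq
  orthogonal x y hxy := by
    simp only [t, ← map_mul]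
    rw [← map_zero of]
    refine of_eq_of fun B _ T hT => ?_
    simpa [FreeStarAlg.eval_gen] using hT.orthogonal x y hxy
  mul l m := by
    simp only [t, ← map_mul]
    refine of_eq_of fun B _ T hT => ?_
    simpa [FreeStarAlg.eval_gen] using hT.mul l m
  toeplitz l m := by
    simp only [star_t]
    rw [finsum_mem_eq_finite_toFinset_sum _ (Λ.minExt_finite l m)]
    simp only [t, ← map_mul, ← map_sum]
    refine of_eq_of fun B _ T hT => ?_
    have := hT.toeplitz l m
    rw [finsum_mem_eq_finite_toFinset_sum _ (Λ.minExt_finite l m)] at this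
    simpa [FreeStarAlg.eval_gen] using this
  sum_eq_one := by
    simp only [t, ← map_sum]
    rw [← map_one of]
    refine of_eq_of fun B _ T hT => ?_
    simpa [FreeStarAlg.eval_gen] using hT.sum_eq_one

variable {B : Type (max u v)} [CStarAlgebra B]

theorem continuous_eval {T : Λ.Path → B} (hT : Λ.IsUnitalToeplitzFamily T) :
    Continuous (FreeStarAlg.eval T : Λ.FreeStarAlg →+* B) :=
  AddMonoidHomClass.continuous_of_bound (FreeStarAlg.eval T : Λ.FreeStarAlg →+* B) 1 fun x => by
    rw [one_mul, norm_def]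
    exact norm_eval_le_universalNorm hT x

/-- The extension to the Toeplitz algebra of evaluation at a family. -/
def liftRingHom (T : Λ.Path → B) (hT : Λ.IsUnitalToeplitzFamily T) : Λ.ToeplitzAlgebra →+* B :=
  Completion.extensionHom (FreeStarAlg.eval T : Λ.FreeStarAlg →+* B) (continuous_eval hT)

theorem liftRingHom_of (T : Λ.Path → B) (hT : Λ.IsUnitalToeplitzFamily T) (x : Λ.FreeStarAlg) :
    liftRingHom T hT (of x) = FreeStarAlg.eval T x :=
  Completion.extensionHom_coe (FreeStarAlg.eval T : Λ.FreeStarAlg →+* B) (continuous_eval hT) x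

theorem continuous_liftRingHom (T : Λ.Path → B) (hT : Λ.IsUnitalToeplitzFamily T) :
    Continuous (liftRingHom T hT) :=
  Completion.continuous_extension

theorem liftRingHom_star (T : Λ.Path → B) (hT : Λ.IsUnitalToeplitzFamily T)
    (a : Λ.ToeplitzAlgebra) : liftRingHom T hT (star a) = star (liftRingHom T hT a) := by
  induction a using ToeplitzAlgebra.induction_on with
  | hc =>
    exact isClosed_eq ((continuous_liftRingHom T hT).comp continuous_star)
      (continuous_star.comp (continuous_liftRingHom T hT))
  | ih x => rw [star_of, liftRingHom_of, liftRingHom_of, FreeStarAlg.eval_star]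

/-- The universal property: a nondegenerate Toeplitz-Cuntz-Krieger family `T` in a C*-algebra
induces a *-homomorphism with `t_λ ↦ T_λ`. -/
def lift (T : Λ.Path → B) (hT : Λ.IsUnitalToeplitzFamily T) : Λ.ToeplitzAlgebra →⋆ₐ[ℂ] B :=
  { liftRingHom T hT with
    commutes' := fun c => by
      change liftRingHom T hT (algebraMap ℂ Λ.ToeplitzAlgebra c) = _
      rw [← AlgHom.commutes of, liftRingHom_of, AlgHom.commutes]
    map_star' := liftRingHom_star T hT }

theorem lift_of (T : Λ.Path → B) (hT : Λ.IsUnitalToeplitzFamily T) (x : Λ.FreeStarAlg) :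
    lift T hT (of x) = FreeStarAlg.eval T x :=
  liftRingHom_of T hT x

theorem lift_t (T : Λ.Path → B) (hT : Λ.IsUnitalToeplitzFamily T) (l : Λ.Path) :
    lift T hT (t l) = T l := by
  rw [t, lift_of, FreeStarAlg.eval_gen]
  rfl

/-! ### The gauge action and the dynamics -/

/-- The scalar `z^n = ∏ z_i^{n_i}`. -/
def torusPow (z : Fin k → Circle) (n : Fin k → ℕ) : ℂ := ∏ i, (z i : ℂ) ^ n i

theorem torusPow_zero (z : Fin k → Circle) : torusPow z 0 = 1 := by simp [torusPow]

theorem torusPow_add (z : Fin k → Circle) (m n : Fin k → ℕ) :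
    torusPow z (m + n) = torusPow z m * torusPow z n := by
  simp [torusPow, pow_add, Finset.prod_mul_distrib]

theorem star_torusPow_mul_self (z : Fin k → Circle) (n : Fin k → ℕ) :
    star (torusPow z n) * torusPow z n = 1 := by
  have h : ‖torusPow z n‖ = 1 := by simp [torusPow, Circle.norm_coe]
  rw [RCLike.star_def, RCLike.conj_mul, h]
  simp

/-- For `z ∈ 𝕋^k`, the family `{z^{d(λ)} t_λ}` is again a Toeplitz-Cuntz-Krieger family. -/
theorem isUnitalToeplitzFamily_gauge (z : Fin k → Circle) :
    Λ.IsUnitalToeplitzFamily (fun l : Λ.Path => torusPow z l.d • t (Λ := Λ) l) := by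
  have h0 : ∀ x : Λ.Vertex, torusPow z (Λ.vertexPath x).d = 1 := fun x =>
    (congrArg (torusPow z) (Λ.deg_id x)).trans (torusPow_zero z)
  have ht := isUnitalToeplitzFamily_t (Λ := Λ)
  refine ⟨⟨fun l => ?_, fun x => ?_, fun x y hxy => ?_, fun l m => ?_, fun l m => ?_⟩, ?_⟩
  · simp only [star_smul, smul_mul_assoc, mul_smul_comm, smul_smul, ht.partial_isometry]
    congr 1
    linear_combination torusPow z l.d * star_torusPow_mul_self z l.d
  · simpa [h0] using ht.projection x
  · simpa [h0] using ht.orthogonal x y hxy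
  · simp only [smul_mul_assoc, mul_smul_comm, smul_smul, ht.mul]
    congr 1
    have : (Path.mk (Λ := Λ) (m ≫ l)).d = (Path.mk l).d + (Path.mk m).d := Λ.deg_comp m l
    rw [this, torusPow_add, mul_comm]
  · rw [star_smul, smul_mul_assoc, mul_smul_comm, smul_smul, ht.toeplitz,
      finsum_mem_eq_finite_toFinset_sum _ (Λ.minExt_finite l m),
      finsum_mem_eq_finite_toFinset_sum _ (Λ.minExt_finite l m), Finset.smul_sum]
    refine Finset.sum_congr rfl fun p hp => ?_
    rw [Set.Finite.mem_toFinset] at hp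
    obtain ⟨h1, h2⟩ := IsMinExt.deg_eq hp
    rw [star_smul, smul_mul_assoc, mul_smul_comm, smul_smul]
    congr 1
    have key : torusPow z l.d * torusPow z p.1.d = torusPow z m.d * torusPow z p.2.d := by
      rw [← torusPow_add, ← torusPow_add, h1, h2]
    linear_combination
      (-(star (torusPow z l.d)) * torusPow z m.d) * star_torusPow_mul_self z p.2.d
        - star (torusPow z l.d) * star (torusPow z p.2.d) * key
        + torusPow z p.1.d * star (torusPow z p.2.d) * star_torusPow_mul_self z l.d
  · simpa [h0] using ht.sum_eq_one

/-- The gauge automorphism `γ_z`, with `γ_z(t_λ) = z^{d(λ)} t_λ`. -/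
def gauge (z : Fin k → Circle) : Λ.ToeplitzAlgebra →⋆ₐ[ℂ] Λ.ToeplitzAlgebra :=
  lift _ (isUnitalToeplitzFamily_gauge z)

/-- The dynamics `α^r_s = γ_{e^{isr}}`. -/
def dynamics (r : Fin k → ℝ) (s : ℝ) : Λ.ToeplitzAlgebra →⋆ₐ[ℂ] Λ.ToeplitzAlgebra :=
  gauge fun i => Circle.exp (s * r i)

end ToeplitzAlgebra

/-! ### KMS states -/

section KMS

variable {A : Type*} [CStarAlgebra A]

/-- A state of a unital C*-algebra: a positive linear functional with `φ(1) = 1`. -/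
structure IsState (φ : A →ₗ[ℂ] ℂ) : Prop where
  nonneg : ∀ a, 0 ≤ φ (star a * a)
  map_one : φ 1 = 1

/-- `F` is an analytic extension to `ℂ` of the map `s ↦ α_s(a)`. -/
def IsAnalyticExtension (α : ℝ → A →⋆ₐ[ℂ] A) (a : A) (F : ℂ → A) : Prop :=
  Differentiable ℂ F ∧ ∀ s : ℝ, F s = α s a

/-- An element `a` is analytic for `α` if `s ↦ α_s(a)` extends to an analytic function on `ℂ`. -/
def IsAnalyticElement (α : ℝ → A →⋆ₐ[ℂ] A) (a : A) : Prop :=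
  ∃ F : ℂ → A, IsAnalyticExtension α a F

/-- A `KMS_β` state: `φ(ab) = φ(b α_{iβ}(a))` for all analytic elements `a`, `b`, where `α_{iβ}(a)`
is the value at `iβ` of the analytic extension of `s ↦ α_s(a)`. -/
structure IsKMSState (α : ℝ → A →⋆ₐ[ℂ] A) (β : ℝ) (φ : A →ₗ[ℂ] ℂ) : Prop
    extends IsState φ where
  kms : ∀ (a b : A) (F : ℂ → A), IsAnalyticExtension α a F → IsAnalyticElement α b →
    φ (a * b) = φ (b * F (Complex.I * β))

end KMS

end HigherRankGraph

end

/-! Say that `x` reaches `w` if `xΛw` is nonempty. The first three claims are order theory. If `x ∈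
H` reaches a vertex of a minimal critical `D`, then the minimal critical `C` that reaches `x` also
reaches `D`; minimality gives `D = C`, and `x`, lying between two vertices of `C`, would belong to
`C`. So `H` is hereditary. Then `H` is a union of strong connectivity classes, and the components of
`Λ \ H` are the components of `Λ` that avoid `H`. Criticality passes back and forth because `ln
ρ(A_{C,j}) = r_j` squeezes the spectral radius of every matrix between `A_{C,j}` and `A_j`. A
critical component is reached from a minimal one, so it lies in `H'`; if it avoids `H` it meets `G`,
and is therefore minimal.

For the KMS states, put `m_x = φ(q_x)`. The projection `q_x` dominates the orthogonal range
projections `t_p t_p*` of the paths of degree `n` into `x`, whose values the KMS condition computes.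
Hence `A_j m ≤ e^{r_j} m`, and `m` vanishes at every vertex reached from a zero of `m`. On a
critical `C` with colour `j`, the restriction of `m` is subinvariant for an irreducible matrix with
spectral radius exactly `e^{r_j}`. By Perron–Frobenius (`IrreducibleMatrix.mulVec_eq`) it is
invariant, which leaves no mass for edges of colour `j` that leave `C`: their sources have weight
zero (`weight_eq_zero_of_exit_edge`).

A path from `C` to `x ∈ H` may leave `C` by an edge of another colour, with source in a component
`D`. The hypothesis on colours then supplies a path from `C` to `D` of colour `j` alone. It leaves
`C` through a vertex of weight zero that reaches `D`, so `m` vanishes on `D`, and hence at `x`.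

Finally, the null space of a KMS state is compatible with multiplication on both sides, so the GNS
representation of `φ` kills `q_x` for `x ∈ H`. The remaining generators form a
Toeplitz–Cuntz–Krieger family of `Λ \ H`. By universality the representation factors through `q`,
and `ψ` is the vector state of the cyclic vector. Its KMS condition is inherited on images of
eigenvectors of the dynamics, which suffice by density and analytic continuation. -/

namespace HigherRankGraph

/-! ### Perron–Frobenius theory for matrices of natural numbers -/

section SpectralRadius

variable {ι κ : Type*}

theorem specRad_eq [Fintype ι] [DecidableEq ι] (A : Matrix ι ι ℕ) :
    specRad A = (spectralRadius ℂ (A.map (fun n : ℕ => (n : ℂ)))).toReal := by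
  unfold specRad
  congr!

theorem irreducibleMatrix_iff [Fintype ι] [DecidableEq ι] (A : Matrix ι ι ℕ) :
    IrreducibleMatrix A ↔ ∀ x w : ι, ∃ m : ℕ, (A ^ m) x w ≠ 0 := by
  unfold IrreducibleMatrix
  congr!

theorem specRad_nonneg [Finite ι] (A : Matrix ι ι ℕ) : 0 ≤ specRad A :=
  ENNReal.toReal_nonneg

/-- A strictly positive subinvariant vector bounds the spectral radius. -/
theorem spectralRadius_le_of_mulVec_le [Fintype ι] [DecidableEq ι] (A : Matrix ι ι ℕ)
    (x : ι → ℝ) (hx : ∀ i, 0 < x i) (c : ℝ)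
    (h : ∀ i, ∑ j, (A i j : ℝ) * x j ≤ c * x i) :
    spectralRadius ℂ (A.map (fun n : ℕ => (n : ℂ))) ≤ ENNReal.ofReal c := by
  refine iSup₂_le fun z hz => ?_
  rw [spectrum.mem_iff, Matrix.isUnit_iff_isUnit_det, isUnit_iff_ne_zero, not_not,
    ← Matrix.exists_mulVec_eq_zero_iff] at hz
  obtain ⟨y, hy, hyz⟩ := hz
  have heig : ∀ i, z * y i = ∑ j, (A i j : ℂ) * y j := by
    intro i
    have := congrFun hyz i
    rw [Matrix.sub_mulVec, Pi.sub_apply, Pi.zero_apply, sub_eq_zero,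
      Algebra.algebraMap_eq_smul_one, Matrix.smul_mulVec, Matrix.one_mulVec] at this
    exact this
  obtain ⟨i₁, hi₁⟩ : ∃ i, y i ≠ 0 := Function.ne_iff.1 hy
  have : Nonempty ι := ⟨i₁⟩
  -- Collatz–Wielandt comparison: evaluate the eigenvalue equation where the eigenvector is largest
  -- relative to `x`.
  obtain ⟨i₀, hi₀⟩ := Finite.exists_max fun i => ‖y i‖ / x i
  set t := ‖y i₀‖ / x i₀ with ht
  have htpos : 0 < t := (div_pos (norm_pos_iff.2 hi₁) (hx i₁)).trans_le (hi₀ i₁)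
  have hle : ∀ j, ‖y j‖ ≤ t * x j := fun j => (div_le_iff₀ (hx j)).1 (hi₀ j)
  have hy₀ : ‖y i₀‖ = t * x i₀ := by rw [ht, div_mul_cancel₀ _ (hx i₀).ne']
  have key : ‖z‖ * (t * x i₀) ≤ c * (t * x i₀) := by
    calc ‖z‖ * (t * x i₀) = ‖∑ j, (A i₀ j : ℂ) * y j‖ := by rw [← heig, norm_mul, hy₀]
      _ ≤ ∑ j, ‖(A i₀ j : ℂ) * y j‖ := norm_sum_le _ _
      _ ≤ ∑ j, t * ((A i₀ j : ℝ) * x j) := by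
        refine Finset.sum_le_sum fun j _ => ?_
        rw [norm_mul, Complex.norm_natCast, mul_left_comm]
        exact mul_le_mul_of_nonneg_left (hle j) (Nat.cast_nonneg _)
      _ = t * ∑ j, (A i₀ j : ℝ) * x j := (Finset.mul_sum _ _ _).symm
      _ ≤ t * (c * x i₀) := mul_le_mul_of_nonneg_left (h i₀) htpos.le
      _ = c * (t * x i₀) := by ring
  have hzc : ‖z‖ ≤ c := le_of_mul_le_mul_right key (mul_pos htpos (hx i₀))
  rw [← enorm_eq_nnnorm, ← ofReal_norm]
  exact ENNReal.ofReal_le_ofReal hzc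

theorem spectralRadius_ne_top [Fintype ι] [DecidableEq ι] (A : Matrix ι ι ℕ) :
    spectralRadius ℂ (A.map (fun n : ℕ => (n : ℂ))) ≠ ⊤ := by
  refine ne_top_of_le_ne_top ENNReal.ofReal_ne_top
    (spectralRadius_le_of_mulVec_le A (fun _ => 1) (fun _ => one_pos)
      (∑ i, ∑ j, (A i j : ℝ)) fun i => ?_)
  simp only [mul_one]
  exact Finset.single_le_sum (f := fun i => ∑ j, (A i j : ℝ))
    (fun _ _ => Finset.sum_nonneg fun _ _ => Nat.cast_nonneg _) (Finset.mem_univ i)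

theorem specRad_le_of_mulVec_le [Fintype ι] (A : Matrix ι ι ℕ)
    (x : ι → ℝ) (hx : ∀ i, 0 < x i) (c : ℝ) (hc : 0 ≤ c)
    (h : ∀ i, ∑ j, (A i j : ℝ) * x j ≤ c * x i) : specRad A ≤ c := by
  classical
  rw [specRad_eq]
  exact ENNReal.toReal_le_of_le_ofReal hc (spectralRadius_le_of_mulVec_le A x hx c h)

theorem map_natCast_pow_apply {R : Type*} [Semiring R] [Fintype ι] [DecidableEq ι]
    (A : Matrix ι ι ℕ) (n : ℕ) (i j : ι) :
    (A.map (fun m : ℕ => (m : R)) ^ n) i j = ((A ^ n) i j : R) :=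
  (congrFun (congrFun (map_pow (Nat.castRingHom R).mapMatrix A n) i) j).symm

theorem pow_submatrix_le [Fintype ι] [DecidableEq ι] [Fintype κ] [DecidableEq κ]
    (A : Matrix κ κ ℕ) (B : Matrix ι ι ℕ) (f : ι → κ) (hf : Function.Injective f)
    (h : ∀ i j, B i j = A (f i) (f j)) (n : ℕ) (i j : ι) :
    (B ^ n) i j ≤ (A ^ n) (f i) (f j) := by
  induction n generalizing i j with
  | zero => simp [Matrix.one_apply, hf.eq_iff]
  | succ n ih =>
    rw [pow_succ, pow_succ, Matrix.mul_apply, Matrix.mul_apply]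
    calc ∑ l, (B ^ n) i l * B l j ≤ ∑ l, (A ^ n) (f i) (f l) * A (f l) (f j) :=
          Finset.sum_le_sum fun l _ => by rw [h]; exact Nat.mul_le_mul_right _ (ih i l)
      _ = ∑ l ∈ Finset.univ.map ⟨f, hf⟩, (A ^ n) (f i) l * A l (f j) := by
          rw [Finset.sum_map]; rfl
      _ ≤ ∑ l, (A ^ n) (f i) l * A l (f j) :=
          Finset.sum_le_sum_of_subset (Finset.subset_univ _)

open scoped Matrix.Norms.Operator in
/-- The spectral radius of a principal submatrix is at most that of the matrix. -/
theorem specRad_le_of_submatrix [Finite ι] [Finite κ] (A : Matrix κ κ ℕ) (B : Matrix ι ι ℕ)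
    (f : ι → κ) (hf : Function.Injective f) (h : ∀ i j, B i j = A (f i) (f j)) :
    specRad B ≤ specRad A := by
  classical
  have := Fintype.ofFinite ι
  have := Fintype.ofFinite κ
  rw [specRad_eq, specRad_eq]
  refine ENNReal.toReal_mono (spectralRadius_ne_top A) ?_
  -- Gelfand's formula in the row-sum norm: entries of powers of the submatrix are dominated by the
  -- corresponding entries of powers of the full matrix.
  refine le_of_tendsto_of_tendsto'
    (spectrum.pow_nnnorm_pow_one_div_tendsto_nhds_spectralRadius _)
    (spectrum.pow_nnnorm_pow_one_div_tendsto_nhds_spectralRadius _) fun n => ?_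
  refine ENNReal.rpow_le_rpow (ENNReal.coe_le_coe.2 ?_) (by positivity)
  rw [Matrix.linfty_opNNNorm_def, Matrix.linfty_opNNNorm_def]
  refine Finset.sup_le fun i _ => ?_
  refine le_trans ?_ (Finset.le_sup (f := fun i => ∑ j, ‖(A.map (fun n : ℕ => (n : ℂ)) ^ n) i j‖₊)
    (Finset.mem_univ (f i)))
  calc ∑ j, ‖(B.map (fun n : ℕ => (n : ℂ)) ^ n) i j‖₊
      ≤ ∑ j, ‖(A.map (fun n : ℕ => (n : ℂ)) ^ n) (f i) (f j)‖₊ := by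
        refine Finset.sum_le_sum fun j _ => ?_
        rw [map_natCast_pow_apply, map_natCast_pow_apply, ← NNReal.coe_le_coe]
        simpa using pow_submatrix_le A B f hf h n i j
    _ = ∑ j ∈ Finset.univ.map ⟨f, hf⟩, ‖(A.map (fun n : ℕ => (n : ℂ)) ^ n) (f i) j‖₊ := by
        rw [Finset.sum_map]; rfl
    _ ≤ _ := Finset.sum_le_sum_of_subset (Finset.subset_univ _)

theorem specRad_reindex [Finite ι] [Finite κ] (A : Matrix κ κ ℕ) (B : Matrix ι ι ℕ)
    (e : ι ≃ κ) (h : ∀ i j, B i j = A (e i) (e j)) : specRad B = specRad A :=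
  le_antisymm (specRad_le_of_submatrix A B e e.injective h)
    (specRad_le_of_submatrix B A e.symm e.symm.injective fun i j => by simp [h])

theorem IrreducibleMatrix.of_reindex [Finite ι] [Finite κ] {A : Matrix κ κ ℕ}
    {B : Matrix ι ι ℕ} (e : ι ≃ κ) (h : ∀ i j, B i j = A (e i) (e j))
    (hB : IrreducibleMatrix B) : IrreducibleMatrix A := by
  classical
  have := Fintype.ofFinite ι
  have := Fintype.ofFinite κ
  rw [irreducibleMatrix_iff] at hB ⊢
  intro x w
  obtain ⟨m, hm⟩ := hB (e.symm x) (e.symm w)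
  refine ⟨m, fun h0 => hm ?_⟩
  have := pow_submatrix_le A B e e.injective h m (e.symm x) (e.symm w)
  simpa [h0] using this

/-- For an irreducible matrix, a nonnegative vector that is subinvariant for the spectral radius is
invariant. -/
theorem IrreducibleMatrix.mulVec_eq [Fintype ι] {A : Matrix ι ι ℕ} (hA : IrreducibleMatrix A)
    (x : ι → ℝ) (hx : ∀ i, 0 ≤ x i)
    (h : ∀ i, ∑ j, (A i j : ℝ) * x j ≤ specRad A * x i) (i : ι) :
    ∑ j, (A i j : ℝ) * x j = specRad A * x i := by
  classical
  by_contra hne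
  rw [irreducibleMatrix_iff] at hA
  set ρ := specRad A with hρ
  let M : Matrix ι ι ℝ := A.map (fun n : ℕ => (n : ℝ))
  have hpow : ∀ (m : ℕ) (a b : ι), (M ^ m) a b = ((A ^ m) a b : ℝ) := map_natCast_pow_apply A
  choose m hm using hA
  obtain ⟨N, hN⟩ : ∃ N, ∀ a b, m a b < N := by
    -- `N` exceeds every exponent `m a b`, so each entry of `P = ∑_{n<N} Mⁿ` has a nonzero summand
    -- and `P` is strictly positive.
    refine ⟨(Finset.univ.sup fun a => Finset.univ.sup fun b => m a b) + 1, fun a b => ?_⟩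
    refine Nat.lt_succ_of_le ?_
    exact (Finset.le_sup (f := fun b => m a b) (Finset.mem_univ b)).trans
      (Finset.le_sup (f := fun a => Finset.univ.sup fun b => m a b) (Finset.mem_univ a))
  let P : Matrix ι ι ℝ := ∑ n ∈ Finset.range N, M ^ n
  have hP : ∀ a b, 0 < P a b := by
    intro a b
    change 0 < (∑ n ∈ Finset.range N, M ^ n) a b
    rw [Matrix.sum_apply]
    refine Finset.sum_pos' (fun n _ => by rw [hpow]; positivity)
      ⟨m a b, Finset.mem_range.2 (hN a b), ?_⟩
    rw [hpow]
    exact_mod_cast Nat.pos_of_ne_zero (hm a b)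
  have hcomm : M * P = P * M :=
    Commute.sum_right _ _ _ fun n _ => (Commute.refl M).pow_right n
  let g : ι → ℝ := ρ • x - M.mulVec x
  have hg : ∀ a, 0 ≤ g a := fun a => sub_nonneg.2 (h a)
  have hgi : 0 < g i := sub_pos.2 (lt_of_le_of_ne (h i) hne)
  let y : ι → ℝ := P.mulVec x
  -- Applying `P`, which commutes with `M`, spreads the defect `g` over all indices: `y = Px` is
  -- strictly subinvariant everywhere, hence strictly positive.
  have hy : ρ • y - M.mulVec y = P.mulVec g := by
    simp only [y, g]
    rw [Matrix.mulVec_sub, Matrix.mulVec_smul, Matrix.mulVec_mulVec, Matrix.mulVec_mulVec, hcomm]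
  have hPg : ∀ a, 0 < P.mulVec g a := fun a =>
    Finset.sum_pos' (fun b _ => mul_nonneg (hP a b).le (hg b))
      ⟨i, Finset.mem_univ _, mul_pos (hP a i) hgi⟩
  have hy0 : ∀ a, 0 ≤ y a := fun a =>
    Finset.sum_nonneg fun b _ => mul_nonneg (hP a b).le (hx b)
  have hMy : ∀ a, 0 ≤ M.mulVec y a := fun a =>
    Finset.sum_nonneg fun b _ => mul_nonneg (Nat.cast_nonneg _) (hy0 b)
  have hlt : ∀ a, M.mulVec y a < ρ * y a := fun a => by
    have := hPg a
    rw [← hy] at this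
    exact sub_pos.1 this
  have hypos : ∀ a, 0 < y a := fun a => by
    refine (hy0 a).lt_of_ne fun h0 => ?_
    have := (hMy a).trans_lt (hlt a)
    rw [← h0, mul_zero] at this
    exact this.false
  have : Nonempty ι := ⟨i⟩
  -- The largest ratio `(My)_a / y_a` is below `ρ`, yet it bounds the spectral radius from above.
  obtain ⟨a₀, ha₀⟩ := Finite.exists_max fun a => M.mulVec y a / y a
  have h1 : ρ ≤ M.mulVec y a₀ / y a₀ :=
    specRad_le_of_mulVec_le A y hypos _ (div_nonneg (hMy _) (hy0 _)) fun a =>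
      (div_le_iff₀ (hypos a)).1 (ha₀ a)
  exact absurd ((le_div_iff₀ (hypos a₀)).1 h1) (not_le.2 (hlt a₀))

end SpectralRadius

variable {k : ℕ} {Λ : HigherRankGraph.{u, v} k}

/-! ### The order on components and the hereditary set `H` -/

section Components

theorem mem_hereditaryClosure_iff {G : Set Λ.Vertex} {w : Λ.Vertex} :
    w ∈ Λ.hereditaryClosure G ↔ ∃ g ∈ G, Nonempty (w ⟶ g) := by
  constructor
  · intro h
    refine h {w | ∃ g ∈ G, Nonempty (w ⟶ g)} ⟨?_, fun g hg => ⟨g, hg, ⟨𝟙 g⟩⟩⟩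
    rintro x w ⟨g, hg, ⟨f⟩⟩ ⟨f'⟩
    exact ⟨g, hg, ⟨f' ≫ f⟩⟩
  · rintro ⟨g, hg, hf⟩ K ⟨hK, hGK⟩
    exact hK (hGK hg) hf

theorem StronglyConnected.refl (x : Λ.Vertex) : Λ.StronglyConnected x x := ⟨⟨𝟙 x⟩, ⟨𝟙 x⟩⟩

theorem StronglyConnected.symm {x w : Λ.Vertex} (h : Λ.StronglyConnected x w) :
    Λ.StronglyConnected w x := ⟨h.2, h.1⟩

theorem StronglyConnected.trans {x w z : Λ.Vertex} (h : Λ.StronglyConnected x w)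
    (h' : Λ.StronglyConnected w z) : Λ.StronglyConnected x z := by
  obtain ⟨⟨f⟩, ⟨g⟩⟩ := h
  obtain ⟨⟨f'⟩, ⟨g'⟩⟩ := h'
  exact ⟨⟨f' ≫ f⟩, ⟨g ≫ g'⟩⟩

theorem component_eq_of_mem {C : Set Λ.Vertex} (hC : C ∈ Λ.components) {x : Λ.Vertex}
    (hx : x ∈ C) : C = {w | Λ.StronglyConnected x w} := by
  obtain ⟨⟨y, rfl⟩, -⟩ := hC
  ext w
  exact ⟨fun h => (StronglyConnected.symm hx).trans h, fun h => StronglyConnected.trans hx h⟩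

theorem mem_component_iff {C : Set Λ.Vertex} (hC : C ∈ Λ.components) {x w : Λ.Vertex}
    (hx : x ∈ C) : w ∈ C ↔ Λ.StronglyConnected x w := by
  conv_lhs => rw [component_eq_of_mem hC hx]
  rfl

theorem nonempty_hom_of_mem_component {C : Set Λ.Vertex} (hC : C ∈ Λ.components) {x w : Λ.Vertex}
    (hx : x ∈ C) (hw : w ∈ C) : Nonempty (w ⟶ x) :=
  ((mem_component_iff hC hx).1 hw).1

theorem component_nonempty {C : Set Λ.Vertex} (hC : C ∈ Λ.components) : C.Nonempty := by
  obtain ⟨⟨y, rfl⟩, -⟩ := hC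
  exact ⟨y, StronglyConnected.refl y⟩

theorem component_eq_component {C D : Set Λ.Vertex} (hC : C ∈ Λ.components)
    (hD : D ∈ Λ.components) {x : Λ.Vertex} (hxC : x ∈ C) (hxD : x ∈ D) : C = D := by
  rw [component_eq_of_mem hC hxC, component_eq_of_mem hD hxD]

/-- Connectivity of components can be tested at any choice of vertices. -/
theorem ConnectedTo.nonempty_hom {C D : Set Λ.Vertex} (hC : C ∈ Λ.components)
    (hD : D ∈ Λ.components) (h : Λ.ConnectedTo C D) {x w : Λ.Vertex} (hx : x ∈ C) (hw : w ∈ D) :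
    Nonempty (w ⟶ x) := by
  obtain ⟨x', hx', w', hw', ⟨f⟩⟩ := h
  obtain ⟨a⟩ := nonempty_hom_of_mem_component hC hx hx'
  obtain ⟨b⟩ := nonempty_hom_of_mem_component hD hw' hw
  exact ⟨b ≫ f ≫ a⟩

theorem ConnectedTo.antisymm {C D : Set Λ.Vertex} (hC : C ∈ Λ.components)
    (hD : D ∈ Λ.components) (h : Λ.ConnectedTo C D) (h' : Λ.ConnectedTo D C) : C = D := by
  obtain ⟨x, hx⟩ := component_nonempty hC
  obtain ⟨w, hw⟩ := component_nonempty hD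
  refine component_eq_component hC hD hx ((mem_component_iff hD hw).2 ?_)
  exact ⟨h'.nonempty_hom hD hC hw hx, h.nonempty_hom hC hD hx hw⟩

theorem ConnectedTo.trans {C D E : Set Λ.Vertex} (hC : C ∈ Λ.components)
    (hD : D ∈ Λ.components) (hE : E ∈ Λ.components) (h : Λ.ConnectedTo C D)
    (h' : Λ.ConnectedTo D E) : Λ.ConnectedTo C E := by
  obtain ⟨x, hx⟩ := component_nonempty hC
  obtain ⟨w, hw⟩ := component_nonempty hD
  obtain ⟨z, hz⟩ := component_nonempty hE
  obtain ⟨f⟩ := h.nonempty_hom hC hD hx hw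
  obtain ⟨g⟩ := h'.nonempty_hom hD hE hw hz
  exact ⟨x, hx, z, hz, ⟨g ≫ f⟩⟩

theorem connectedTo_self {C : Set Λ.Vertex} (hC : C ∈ Λ.components) : Λ.ConnectedTo C C := by
  obtain ⟨x, hx⟩ := component_nonempty hC
  exact ⟨x, hx, x, hx, ⟨𝟙 x⟩⟩

variable [Λ.IsFinite] {r : Fin k → ℝ}

/-- Every critical component is dominated by a minimal critical component. -/
theorem exists_minCritical_connectedTo {D : Set Λ.Vertex} (hD : D ∈ Λ.critical r) :
    ∃ E ∈ Λ.minCritical r, Λ.ConnectedTo E D := by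
  have := Λ.finite_vertex
  -- The strict part of the partial order, well-founded because there are finitely many vertices.
  let R : Λ.components → Λ.components → Prop := fun E F => E ≠ F ∧ Λ.ConnectedTo E.1 F.1
  have hirr : Std.Irrefl R := ⟨fun E h => h.1 rfl⟩
  have htr : IsTrans Λ.components R := ⟨fun E F G h h' =>
    ⟨fun hEG => by
      subst hEG
      exact h.1 (Subtype.ext (h.2.antisymm E.2 F.2 h'.2)), h.2.trans E.2 F.2 G.2 h'.2⟩⟩
  have hwf : WellFounded R := Finite.wellFounded_of_trans_of_irrefl R
  obtain ⟨E, ⟨hEc, hED⟩, hmin⟩ := hwf.has_min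
    {E | E.1 ∈ Λ.critical r ∧ Λ.ConnectedTo E.1 D} ⟨⟨D, hD.1⟩, hD, connectedTo_self hD.1⟩
  refine ⟨E.1, ⟨hEc, fun F hF hFE => ?_⟩, hED⟩
  by_contra hne
  exact hmin ⟨F, hF.1⟩ ⟨hF, hFE.trans hF.1 E.2 hD.1 hED⟩
    ⟨fun h => hne (congrArg Subtype.val h), hFE⟩

theorem mem_redundantSet_iff {x : Λ.Vertex} :
    x ∈ Λ.redundantSet r ↔
      (∃ C ∈ Λ.minCritical r, ∃ c ∈ C, Nonempty (x ⟶ c)) ∧ ∀ C ∈ Λ.minCritical r, x ∉ C := by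
  rw [redundantSet, Set.mem_sdiff, mem_hereditaryClosure_iff]
  simp only [Set.mem_sUnion]
  grind

/-- A vertex of a minimal critical component that is reached from a minimal critical component lies
in that component. -/
theorem mem_of_minCritical {C D : Set Λ.Vertex} (hC : C ∈ Λ.minCritical r)
    (hD : D ∈ Λ.minCritical r) {c x : Λ.Vertex} (hc : c ∈ C) (hx : x ∈ D)
    (h : Nonempty (x ⟶ c)) : x ∈ C := by
  rw [hD.2 C hC.1 ⟨c, hc, x, hx, h⟩]
  exact hx

variable (Λ r) in
theorem isHereditary_redundantSet : Λ.IsHereditary (Λ.redundantSet r) := by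
  rintro x w hx ⟨f⟩
  rw [mem_redundantSet_iff] at hx ⊢
  obtain ⟨⟨C, hC, c, hc, ⟨g⟩⟩, hx⟩ := hx
  refine ⟨⟨C, hC, c, hc, ⟨f ≫ g⟩⟩, fun D hD hw => hx C hC ?_⟩
  -- A vertex `w ∈ G` reached from `x` lies in the same `C` that reaches `x`; returning from `w` to
  -- `c` closes a cycle through `x`, so `x ∈ C`.
  have hwC := mem_of_minCritical hC hD hc hw ⟨f ≫ g⟩
  obtain ⟨e⟩ := nonempty_hom_of_mem_component hC.1.1 hwC hc
  exact (mem_component_iff hC.1.1 hc).2 ⟨⟨g⟩, ⟨e ≫ f⟩⟩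

end Components

/-! ### Components and critical components of `Λ \ H` -/

section Remove

variable {H : Set Λ.Vertex} (hH : Λ.IsHereditary H)

/-- A member of the class of `x` reaches `x`, so by heredity it cannot be in `H`: removing `H` never
cuts a class. -/
theorem image_stronglyConnected_remove (x : (Λ.remove H hH).Vertex) :
    Subtype.val '' {w : {x : Λ.Vertex // x ∉ H} | (Λ.remove H hH).StronglyConnected x w} =
      {w | Λ.StronglyConnected x.1 w} := by
  ext w
  constructor
  · rintro ⟨w, hw, rfl⟩
    exact hw
  · intro hw
    exact ⟨⟨w, fun h => x.2 (hH h hw.2)⟩, hw, rfl⟩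

theorem mem_components_remove_iff (D : Set {x : Λ.Vertex // x ∉ H}) :
    D ∈ (Λ.remove H hH).components ↔ Subtype.val '' D ∈ Λ.components := by
  have h1 : (∃ x, D = {w | (Λ.remove H hH).StronglyConnected x w}) ↔
      ∃ x, Subtype.val '' D = {w | Λ.StronglyConnected x w} := by
    constructor
    · rintro ⟨x, rfl⟩
      exact ⟨x.1, image_stronglyConnected_remove hH x⟩
    · rintro ⟨x, hx⟩
      obtain ⟨x, hxD, rfl⟩ : x ∈ Subtype.val '' D := by
        rw [hx]; exact StronglyConnected.refl x
      refine ⟨x, Subtype.val_injective.image_injective ?_⟩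
      rw [hx]
      exact (image_stronglyConnected_remove hH x).symm
  have h2 : (∃ x : (Λ.remove H hH).Vertex, D = {x} ∧ ∀ f : x ⟶ x, f = 𝟙 x) ↔
      ∃ x : Λ.Vertex, Subtype.val '' D = {x} ∧ ∀ f : x ⟶ x, f = 𝟙 x := by
    constructor
    · rintro ⟨x, rfl, hx⟩
      exact ⟨x.1, Set.image_singleton, hx⟩
    · rintro ⟨x, hD, hx⟩
      obtain ⟨x, hxD, rfl⟩ : x ∈ Subtype.val '' D := by rw [hD]; rfl
      refine ⟨x, Subtype.val_injective.image_injective ?_, hx⟩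
      rw [hD]
      exact Set.image_singleton.symm
  exact and_congr h1 (not_congr h2)

variable [Λ.IsFinite] {r : Fin k → ℝ}

theorem log_specRad_vertexMatrix_le (hr : ∀ i, 0 < r i) (hnorm : Λ.Normalised r) (i : Fin k) :
    Real.log (specRad (Λ.vertexMatrix i)) ≤ r i := by
  have := hnorm.2 ⟨i, rfl⟩
  rwa [inv_mul_le_iff₀ (hr i), mul_one] at this

theorem mem_criticalColours_iff (hr : ∀ i, 0 < r i) (i : Fin k) :
    i ∈ Λ.criticalColours r ↔ Real.log (specRad (Λ.vertexMatrix i)) = r i := by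
  rw [criticalColours, Set.mem_ofPred_eq, inv_mul_eq_iff_eq_mul₀ (hr i).ne', mul_one]

/-- Positivity of the smaller logarithm excludes spectral radius zero, where `Real.log` takes the
default value `0` and monotonicity could fail. -/
theorem log_specRad_mono {ι κ : Type*} [Finite ι] [Finite κ] (A : Matrix κ κ ℕ)
    (B : Matrix ι ι ℕ) (f : ι → κ) (hf : Function.Injective f)
    (h : ∀ i j, B i j = A (f i) (f j)) (hB : 0 < Real.log (specRad B)) :
    Real.log (specRad B) ≤ Real.log (specRad A) := by
  refine Real.log_le_log ((specRad_nonneg B).lt_of_ne fun h0 => ?_)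
    (specRad_le_of_submatrix A B f hf h)
  rw [← h0, Real.log_zero] at hB
  exact hB.false

/-- The condition `j ∈ K` is automatic: `r_j = ln ρ(A_{C,j}) ≤ ln ρ(A_j) ≤ r_j`. -/
theorem mem_critical_iff (hr : ∀ i, 0 < r i) (hnorm : Λ.Normalised r) (C : Set Λ.Vertex) :
    haveI := Λ.finite_vertex
    C ∈ Λ.critical r ↔ C ∈ Λ.components ∧ ∃ j,
      r j = Real.log (specRad (Λ.blockMatrix C j)) ∧ IrreducibleMatrix (Λ.blockMatrix C j) := by
  have := Λ.finite_vertex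
  refine and_congr_right fun hC => ⟨fun ⟨j, _, h⟩ => ⟨j, h⟩, fun ⟨j, h, h'⟩ => ⟨j, ?_, h, h'⟩⟩
  rw [mem_criticalColours_iff hr]
  refine le_antisymm (log_specRad_vertexMatrix_le hr hnorm j) ?_
  rw [h]
  exact log_specRad_mono _ _ Subtype.val Subtype.val_injective (fun _ _ => rfl) (h ▸ hr j)

/-- The blocks agree up to relabelling. Only the set `K` of `Λ \ H` could differ, and the vertex
matrix of `Λ \ H` sits between `A_{C,j}` and `A_j`, so its logarithmic spectral radius is again
`r_j`. -/
theorem mem_critical_remove_iff (hr : ∀ i, 0 < r i) (hnorm : Λ.Normalised r)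
    (D : Set {x : Λ.Vertex // x ∉ H}) :
    D ∈ (Λ.remove H hH).critical r ↔ Subtype.val '' D ∈ Λ.critical r := by
  have := Λ.finite_vertex
  have := (Λ.remove H hH).finite_vertex
  rw [mem_critical_iff hr hnorm, ← mem_components_remove_iff hH]
  let e : (D : Set (Λ.remove H hH).Vertex) ≃ (Subtype.val '' D : Set Λ.Vertex) :=
    Equiv.Set.image _ D Subtype.val_injective
  have he : ∀ (j : Fin k) (a b : (D : Set (Λ.remove H hH).Vertex)),
      (Λ.remove H hH).blockMatrix D j a b = Λ.blockMatrix (Subtype.val '' D) j (e a) (e b) :=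
    fun _ _ _ => rfl
  refine and_congr_right fun hD => ⟨?_, ?_⟩
  · rintro ⟨j, -, h, h'⟩
    exact ⟨j, h.trans (congrArg Real.log (specRad_reindex _ _ e (he j))), h'.of_reindex e (he j)⟩
  · rintro ⟨j, h, h'⟩
    have h1 : r j = Real.log (specRad ((Λ.remove H hH).blockMatrix D j)) :=
      h.trans (congrArg Real.log (specRad_reindex _ _ e (he j)).symm)
    refine ⟨j, ?_, h1, h'.of_reindex e.symm fun a b =>
      congrArg₂ (Λ.blockMatrix (Subtype.val '' D) j) (e.apply_symm_apply a).symm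
        (e.apply_symm_apply b).symm⟩
    rw [mem_criticalColours_iff hr]
    have h2 : r j ≤ Real.log (specRad ((Λ.remove H hH).vertexMatrix j)) :=
      h1.trans_le (log_specRad_mono _ _ Subtype.val Subtype.val_injective (fun _ _ => rfl)
        ((hr j).trans_eq h1))
    refine le_antisymm ?_ h2
    exact (log_specRad_mono (Λ.vertexMatrix j) ((Λ.remove H hH).vertexMatrix j) Subtype.val
      Subtype.val_injective (fun _ _ => rfl) ((hr j).trans_le h2)).trans
      (log_specRad_vertexMatrix_le hr hnorm j)

theorem notMem_redundantSet_of_minCritical {C : Set Λ.Vertex} (hC : C ∈ Λ.minCritical r)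
    {x : Λ.Vertex} (hx : x ∈ C) : x ∉ Λ.redundantSet r := fun h =>
  (mem_redundantSet_iff.1 h).2 C hC hx

/-- The critical components of `Λ \ H` are the minimal critical components of `Λ`. -/
theorem critical_remove_redundantSet (hr : ∀ i, 0 < r i) (hnorm : Λ.Normalised r)
    (hH : Λ.IsHereditary (Λ.redundantSet r)) :
    (fun D : Set {x : Λ.Vertex // x ∉ Λ.redundantSet r} => Subtype.val '' D) ''
      (Λ.remove (Λ.redundantSet r) hH).critical r = Λ.minCritical r := by
  ext C
  constructor
  · rintro ⟨D, hD, rfl⟩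
    have hD' := (mem_critical_remove_iff hH hr hnorm D).1 hD
    obtain ⟨E, hE, hED⟩ := exists_minCritical_connectedTo hD'
    have hED' := hED
    obtain ⟨e, he, w, hw, hwe⟩ := hED
    obtain ⟨w, hwD, rfl⟩ := id hw
    have hwH := w.2
    rw [mem_redundantSet_iff] at hwH
    push Not at hwH
    -- `w` is in `H'` but not in `H`, hence in some minimal critical `F`, which must be the
    -- component of `w`.
    obtain ⟨F, hF, hwF⟩ := hwH ⟨E, hE, e, he, hwe⟩
    change Subtype.val '' D ∈ Λ.minCritical r
    rwa [component_eq_component hD'.1 hF.1.1 hw hwF]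
  · intro hC
    have himg : Subtype.val '' {x : {x : Λ.Vertex // x ∉ Λ.redundantSet r} | x.1 ∈ C} = C := by
      ext x
      exact ⟨by rintro ⟨x, hx, rfl⟩; exact hx,
        fun hx => ⟨⟨x, notMem_redundantSet_of_minCritical hC hx⟩, hx, rfl⟩⟩
    refine ⟨{x | x.1 ∈ C}, (mem_critical_remove_iff hH hr hnorm _).2 ?_, himg⟩
    rw [himg]
    exact hC.1

theorem isHereditary_minCritical_remove {C : Set Λ.Vertex} (hC : C ∈ Λ.minCritical r)
    (hH : Λ.IsHereditary (Λ.redundantSet r)) :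
    (Λ.remove (Λ.redundantSet r) hH).IsHereditary
      {x : {x : Λ.Vertex // x ∉ Λ.redundantSet r} | x.1 ∈ C} := by
  rintro ⟨x, hx⟩ ⟨w, hw⟩ hxC ⟨f⟩
  change w ∈ C
  rw [mem_redundantSet_iff] at hw
  push Not at hw
  obtain ⟨D, hD, hwD⟩ := hw ⟨C, hC, x, hxC, ⟨f⟩⟩
  exact mem_of_minCritical hC hD hxC hwD ⟨f⟩

end Remove

/-! ### Edges that leave a set of vertices -/

section Exit

theorem exists_edge_factorisation {w x : Λ.Vertex} (f : w ⟶ x) (i : Fin k)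
    (hi : 0 < Λ.deg f i) : ∃ (y : Λ.Vertex) (g : y ⟶ x) (g' : w ⟶ y),
      Λ.deg g = Pi.single i 1 ∧ Λ.deg f = Pi.single i 1 + Λ.deg g' := by
  have hle : (Pi.single i 1 : Fin k → ℕ) ≤ Λ.deg f := by
    intro l
    by_cases h : l = i
    · subst h; simpa using Nat.succ_le_of_lt hi
    · simp [h]
  obtain ⟨⟨y, g, g'⟩, ⟨h1, h2, h3⟩, -⟩ := Λ.factorisation f (Pi.single i 1)
    (Λ.deg f - Pi.single i 1) (add_tsub_cancel_of_le hle).symm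
  refine ⟨y, g, g', h1, ?_⟩
  rw [h2]
  exact (add_tsub_cancel_of_le hle).symm

/-- Both ways of composing `f` with an identity factor it along `0 = 0 + 0`, so uniqueness
identifies them. -/
theorem exists_eqToHom_of_deg_eq_zero {w x : Λ.Vertex} (f : w ⟶ x) (hf : Λ.deg f = 0) :
    ∃ h : w = x, f = eqToHom h := by
  obtain ⟨p, -, hp⟩ := Λ.factorisation f 0 0 (by simpa using hf)
  have h1 := hp ⟨w, f, 𝟙 w⟩ ⟨hf, Λ.deg_id w, Category.id_comp f⟩
  have h2 := hp ⟨x, 𝟙 x, f⟩ ⟨Λ.deg_id x, hf, Category.comp_id f⟩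
  have h := h1.trans h2.symm
  obtain rfl : w = x := congrArg Sigma.fst h
  exact ⟨rfl, congrArg Prod.fst (eq_of_heq (Sigma.mk.inj h).2)⟩

/-- A path with range in `C` and source outside `C` contains an edge leaving `C`, and the source of
this edge reaches the source of the path. The colour of the edge occurs in the path. -/
theorem exists_exit_edge {C : Set Λ.Vertex} : ∀ {w x : Λ.Vertex} (f : w ⟶ x), x ∈ C → w ∉ C →
    ∃ (i : Fin k) (a b : Λ.Vertex) (e : b ⟶ a), 0 < Λ.deg f i ∧ a ∈ C ∧ b ∉ C ∧
      Λ.deg e = Pi.single i 1 ∧ Nonempty (w ⟶ b) := by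
  -- Induction on the length `|d(f)|`: split off an edge at the range; either it leaves `C`, or the
  -- rest of the path starts again in `C`.
  suffices h : ∀ (N : ℕ) {w x : Λ.Vertex} (f : w ⟶ x), ∑ l, Λ.deg f l = N → x ∈ C → w ∉ C →
      ∃ (i : Fin k) (a b : Λ.Vertex) (e : b ⟶ a), 0 < Λ.deg f i ∧ a ∈ C ∧ b ∉ C ∧
        Λ.deg e = Pi.single i 1 ∧ Nonempty (w ⟶ b) from
    fun {_ _} f => h _ f rfl
  intro N
  induction N with
  | zero =>
    intro w x f hf hx hw
    have h0 : Λ.deg f = 0 := by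
      ext l
      exact Finset.sum_eq_zero_iff.1 hf l (Finset.mem_univ l)
    exact absurd ((exists_eqToHom_of_deg_eq_zero f h0).1 ▸ hx) hw
  | succ N ih =>
    intro w x f hf hx hw
    obtain ⟨i, -, hi⟩ : ∃ i ∈ Finset.univ, 0 < Λ.deg f i :=
      Finset.exists_lt_of_sum_lt (by simp [hf])
    obtain ⟨y, g, g', hg, hfg⟩ := exists_edge_factorisation f i hi
    by_cases hy : y ∈ C
    · obtain ⟨j, a, b, e, hj, h⟩ := ih g' (by
        have : ∑ l, Λ.deg f l = 1 + ∑ l, Λ.deg g' l := by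
          rw [hfg]
          simp [Finset.sum_add_distrib]
        omega) hy hw
      exact ⟨j, a, b, e, by rw [hfg, Pi.add_apply]; omega, h⟩
    · exact ⟨i, x, y, g, hi, hx, hy, hg, ⟨g'⟩⟩

end Exit

/-! ### States: continuity and Cauchy–Schwarz -/

section States

variable {A : Type*} [CStarAlgebra A] {φ : A →ₗ[ℂ] ℂ}

/-- A state as a positive linear map. -/
noncomputable def IsState.toPositiveLinearMap [PartialOrder A] [StarOrderedRing A] (h : IsState φ) :
    A →ₚ[ℂ] ℂ :=
  PositiveLinearMap.mk₀ φ fun x hx => by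
    rw [StarOrderedRing.nonneg_iff] at hx
    induction hx using AddSubmonoid.closure_induction with
    | mem x hx =>
      obtain ⟨s, rfl⟩ := hx
      exact h.nonneg s
    | zero => rw [map_zero]
    | add x y _ _ hx hy =>
      rw [map_add]
      exact add_nonneg hx hy

theorem IsState.continuous (h : IsState φ) : Continuous φ := by
  let _ := CStarAlgebra.spectralOrder A
  have := CStarAlgebra.spectralOrderedRing A
  exact map_continuous h.toPositiveLinearMap

open scoped InnerProductSpace in
-- Cauchy–Schwarz: `φ(ab)` is the GNS inner product of `a*` with the null vector `b`.
theorem IsState.apply_mul_eq_zero (h : IsState φ) {b : A} (hb : φ (star b * b) = 0) (a : A) :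
    φ (a * b) = 0 := by
  let _ := CStarAlgebra.spectralOrder A
  have := CStarAlgebra.spectralOrderedRing A
  let f := h.toPositiveLinearMap
  have h1 : ‖f.toPreGNS b‖ = 0 := by
    rw [← sq_eq_zero_iff, ← Complex.ofReal_eq_zero, Complex.ofReal_pow, f.preGNS_norm_sq]
    exact hb
  have h2 := norm_inner_le_norm (𝕜 := ℂ) (f.toPreGNS (star a)) (f.toPreGNS b)
  rw [h1, mul_zero, norm_le_zero_iff, f.preGNS_inner_def] at h2
  rwa [f.ofPreGNS_toPreGNS, f.ofPreGNS_toPreGNS, star_star] at h2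

end States

/-! ### KMS states and eigenvectors of the dynamics -/

section KMS

variable {A : Type*} [CStarAlgebra A] {α : ℝ → A →⋆ₐ[ℂ] A} {φ : A →ₗ[ℂ] ℂ}

/-- An eigenvector of the dynamics `α`, with `α_s(a) = e^{isc} a`. -/
def IsHomogeneous (α : ℝ → A →⋆ₐ[ℂ] A) (c : ℝ) (a : A) : Prop :=
  ∀ s : ℝ, α s a = Complex.exp (Complex.I * s * c) • a

theorem IsHomogeneous.isAnalyticExtension {c : ℝ} {a : A} (h : IsHomogeneous α c a) :
    IsAnalyticExtension α a fun z => Complex.exp (Complex.I * z * c) • a :=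
  ⟨by fun_prop, fun s => (h s).symm⟩

theorem isHomogeneous_algebraMap (z : ℂ) : IsHomogeneous α 0 (algebraMap ℂ A z) := fun s => by
  rw [AlgHomClass.commutes, Complex.ofReal_zero, mul_zero, Complex.exp_zero, one_smul]

theorem IsHomogeneous.mul {c d : ℝ} {a b : A} (ha : IsHomogeneous α c a)
    (hb : IsHomogeneous α d b) : IsHomogeneous α (c + d) (a * b) := fun s => by
  rw [map_mul, ha, hb, smul_mul_smul_comm, ← Complex.exp_add]
  push_cast
  ring_nf

theorem IsHomogeneous.star {c : ℝ} {a : A} (ha : IsHomogeneous α c a) :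
    IsHomogeneous α (-c) (star a) := fun s => by
  rw [map_star, ha, star_smul, Complex.star_def, ← Complex.exp_conj]
  simp

theorem IsHomogeneous.map {B : Type*} [CStarAlgebra B] {β : ℝ → B →⋆ₐ[ℂ] B} {q : A →⋆ₐ[ℂ] B}
    (hq : ∀ s a, q (α s a) = β s (q a)) {c : ℝ} {a : A} (ha : IsHomogeneous α c a) :
    IsHomogeneous β c (q a) := fun s => by
  rw [← hq, ha, map_smul]

theorem continuous_starAlgHom {B : Type*} [CStarAlgebra B] (q : A →⋆ₐ[ℂ] B) : Continuous q :=
  AddMonoidHomClass.continuous_of_bound q 1 fun a => by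
    rw [one_mul]
    exact NonUnitalStarAlgHom.norm_apply_le q a

/-- Continuous linear functionals that agree on a set with dense span are equal. -/
theorem linearMap_ext_of_dense_span {T : Set A} (hT : Dense (Submodule.span ℂ T : Set A))
    {f g : A →ₗ[ℂ] ℂ} (hf : Continuous f) (hg : Continuous g) (h : ∀ a ∈ T, f a = g a) (a : A) :
    f a = g a :=
  congrFun (hf.ext_on hT hg fun _ hx => LinearMap.eqOn_span h hx) a

/-- The extension of an eigenvector at `i` is `e^{-c} a`. The KMS condition gives the identity for
homogeneous `b`, and continuity extends it to every `b`, analytic or not. -/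
theorem IsKMSState.apply_mul_of_isHomogeneous (h : IsKMSState α 1 φ)
    (hα : Dense (Submodule.span ℂ {a : A | ∃ c, IsHomogeneous α c a} : Set A)) {c : ℝ} {a : A}
    (ha : IsHomogeneous α c a) (b : A) : φ (a * b) = Complex.exp (-c) * φ (b * a) := by
  have hc := h.toIsState.continuous
  refine linearMap_ext_of_dense_span (f := φ ∘ₗ LinearMap.mulLeft ℂ a)
    (g := (Complex.exp (-c)) • (φ ∘ₗ LinearMap.mulRight ℂ a)) hα
    (hc.comp (continuous_const_mul a)) ((hc.comp (continuous_mul_const a)).const_smul _) ?_ b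
  rintro b ⟨d, hb⟩
  have := h.kms a b _ ha.isAnalyticExtension ⟨_, hb.isAnalyticExtension⟩
  simp only [LinearMap.comp_apply, LinearMap.mulLeft_apply, LinearMap.smul_apply,
    LinearMap.mulRight_apply, smul_eq_mul]
  rw [this, mul_smul_comm, map_smul, smul_eq_mul]
  congr 2
  rw [Complex.ofReal_one, mul_one, Complex.I_mul_I, neg_one_mul]

/-- The null ideal of a KMS state: if `φ(b*b) = 0`, then `φ(a b x) = 0` for all `a`, `x`. -/
theorem IsKMSState.apply_mul_mul_eq_zero (h : IsKMSState α 1 φ)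
    (hα : Dense (Submodule.span ℂ {a : A | ∃ c, IsHomogeneous α c a} : Set A)) {b : A}
    (hb : φ (star b * b) = 0) (a x : A) : φ (a * b * x) = 0 := by
  have hc := h.toIsState.continuous
  refine linearMap_ext_of_dense_span (f := φ ∘ₗ LinearMap.mulLeft ℂ (a * b)) (g := 0) hα
    (hc.comp (continuous_const_mul _)) continuous_const ?_ x
  rintro x ⟨c, hx⟩
  -- Moving a homogeneous `x` to the far left costs only a nonzero scalar and leaves `b` last, where
  -- Cauchy–Schwarz applies.
  have h1 := h.apply_mul_of_isHomogeneous hα hx (a * b)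
  rw [← mul_assoc, h.toIsState.apply_mul_eq_zero hb, eq_comm, mul_eq_zero] at h1
  exact h1.resolve_left (Complex.exp_ne_zero _)

/-- The KMS condition can be checked on homogeneous elements with dense span. -/
theorem IsKMSState.of_isHomogeneous (hφ : IsState φ) {T : Set A}
    (hT : Dense (Submodule.span ℂ T : Set A))
    (h : ∀ a ∈ T, ∃ c, IsHomogeneous α c a ∧
      ∀ b, φ (a * b) = Complex.exp (-c) * φ (b * a)) : IsKMSState α 1 φ := by
  refine ⟨hφ, fun a b F ⟨hF, hFα⟩ _ => ?_⟩
  have hc := hφ.continuous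
  -- Invariance under the dynamics: taking `b = 1` gives `φ(x) = e^{-c} φ(x)`, so `φ` kills
  -- eigenvectors with `c ≠ 0`.
  have hinv : ∀ s a, φ (α s a) = φ a := by
    intro s a
    refine linearMap_ext_of_dense_span (f := φ ∘ₗ (α s).toAlgHom.toLinearMap) hT
      (hc.comp (continuous_starAlgHom (α s))) hc ?_ a
    intro x hx
    obtain ⟨c, hxc, hx⟩ := h x hx
    change φ (α s x) = φ x
    rw [hxc, map_smul, smul_eq_mul]
    by_cases h0 : c = 0
    · simp [h0]
    · have h1 := hx 1
      rw [mul_one, one_mul] at h1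
      have h2 : φ x = 0 := by
        by_contra hne
        have h3 : Complex.exp (-c) = 1 := by
          refine mul_right_cancel₀ hne ?_
          rw [one_mul]
          exact h1.symm
        rw [← Complex.ofReal_neg, ← Complex.ofReal_exp, Complex.ofReal_eq_one,
          Real.exp_eq_one_iff] at h3
        exact h0 (neg_eq_zero.1 h3)
      rw [h2, mul_zero]
  refine linearMap_ext_of_dense_span (f := φ ∘ₗ LinearMap.mulLeft ℂ a)
    (g := φ ∘ₗ LinearMap.mulRight ℂ (F (Complex.I * (1 : ℝ)))) hT
    (hc.comp (continuous_const_mul _)) (hc.comp (continuous_mul_const _)) ?_ b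
  intro b hb
  obtain ⟨c, hbc, hb⟩ := h b hb
  change φ (a * b) = φ (b * F (Complex.I * (1 : ℝ)))
  let L : A →L[ℂ] ℂ := ⟨φ ∘ₗ LinearMap.mulRight ℂ b, hc.comp (continuous_mul_const b)⟩
  have hentire : Differentiable ℂ fun z => φ (F z * b) := fun z =>
    L.differentiableAt.comp z (hF z)
  have hentire' : Differentiable ℂ fun z : ℂ => Complex.exp (-(Complex.I * z * c)) * φ (a * b) := by
    fun_prop
  have hreal : ∀ s : ℝ, φ (F s * b) = Complex.exp (-(Complex.I * s * c)) * φ (a * b) := by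
    intro s
    have h1 : α s (a * b) = Complex.exp (Complex.I * s * c) • (F s * b) := by
      rw [map_mul, hbc, ← hFα, mul_smul_comm]
    have h2 := hinv s (a * b)
    rw [h1, map_smul, smul_eq_mul] at h2
    rw [← h2, ← mul_assoc, ← Complex.exp_add, neg_add_cancel, Complex.exp_zero, one_mul]
  -- Two entire functions that agree on the real line by invariance; the points `1/(n+1)` accumulate
  -- at `0`. At `z = i` this gives `φ(F(i) b) = e^{c} φ(ab)`, cancelling the factor `e^{-c}` from
  -- `hb`.
  have hall : (fun z => φ (F z * b)) =
      fun z : ℂ => Complex.exp (-(Complex.I * z * c)) * φ (a * b) := by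
    refine AnalyticOnNhd.eq_of_frequently_eq (z₀ := 0)
      (fun z _ => hentire.analyticAt z) (fun z _ => hentire'.analyticAt z) ?_
    have h1 : Filter.Tendsto (fun n : ℕ => (((1 / ((n : ℝ) + 1) : ℝ)) : ℂ)) Filter.atTop
        (nhdsWithin 0 {0}ᶜ) := by
      refine tendsto_nhdsWithin_iff.2 ⟨?_, Filter.Eventually.of_forall fun n => ?_⟩
      · have := (Complex.continuous_ofReal.tendsto 0).comp
          (tendsto_one_div_add_atTop_nhds_zero_nat (𝕜 := ℝ))
        rwa [Complex.ofReal_zero] at this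
      · have : (1 / ((n : ℝ) + 1) : ℝ) ≠ 0 := by positivity
        exact Complex.ofReal_ne_zero.2 this
    exact h1.frequently (Filter.Frequently.of_forall fun n => hreal _)
  have hI := congrFun hall (Complex.I * (1 : ℝ))
  change φ (F (Complex.I * (1 : ℝ)) * b) = _ at hI
  rw [hb, hI, ← mul_assoc, ← Complex.exp_add, Complex.ofReal_one, mul_one, Complex.I_mul_I]
  simp

end KMS

variable {k : ℕ} {Λ : HigherRankGraph.{u, v} k}

/-! ### Relations in a Toeplitz–Cuntz–Krieger family -/

section Families

theorem minExt_self (l : Λ.Path) :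
    Λ.minExt l l = {(Λ.vertexPath l.src, Λ.vertexPath l.src)} := by
  ext ⟨a, b⟩
  constructor
  · intro h
    have h1 := IsMinExt.deg_eq h
    rw [sup_idem, add_eq_left, add_eq_left] at h1
    obtain ⟨l, m, a, b, comm, hdeg⟩ := h
    obtain ⟨rfl, rfl⟩ := exists_eqToHom_of_deg_eq_zero a h1.1
    obtain ⟨-, rfl⟩ := exists_eqToHom_of_deg_eq_zero b h1.2
    rfl
  · rintro h
    obtain ⟨rfl, rfl⟩ := Prod.mk.inj (Set.mem_singleton_iff.1 h)
    exact IsMinExt.mk l.hom l.hom (𝟙 _) (𝟙 _) rfl (by rw [Category.id_comp, sup_idem])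

/-- For equal degrees, a minimal common extension adds only paths of degree zero, which forces `l =
m`. This makes range projections of one degree orthogonal. -/
theorem minExt_eq_empty {l m : Λ.Path} (hd : l.d = m.d) (hne : l ≠ m) : Λ.minExt l m = ∅ := by
  ext ⟨a, b⟩
  refine iff_of_false (fun h => ?_) (Set.notMem_empty _)
  have h1 := IsMinExt.deg_eq h
  rw [← hd, sup_idem, add_eq_left, add_eq_left] at h1
  obtain ⟨l, m, a, b, comm, hdeg⟩ := h
  obtain ⟨rfl, rfl⟩ := exists_eqToHom_of_deg_eq_zero a h1.1
  obtain ⟨rfl, rfl⟩ := exists_eqToHom_of_deg_eq_zero b h1.2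
  rw [eqToHom_refl, Category.id_comp, Category.id_comp] at comm
  exact hne (comm ▸ rfl)

namespace IsToeplitzFamily

variable {B : Type*} [NonUnitalRing B] [StarRing B] {T : Λ.Path → B}

theorem mul_source (hT : Λ.IsToeplitzFamily T) (l : Λ.Path) :
    T l * T (Λ.vertexPath l.src) = T l := by
  have := hT.mul l.hom (𝟙 l.src)
  rwa [Category.id_comp] at this

theorem range_mul (hT : Λ.IsToeplitzFamily T) (l : Λ.Path) :
    T (Λ.vertexPath l.rng) * T l = T l := by
  have := hT.mul (𝟙 l.rng) l.hom
  rwa [Category.comp_id] at this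

theorem eq_zero_of_source (hT : Λ.IsToeplitzFamily T) {l : Λ.Path}
    (h : T (Λ.vertexPath l.src) = 0) : T l = 0 := by
  rw [← hT.mul_source, h, mul_zero]

theorem star_vertex (hT : Λ.IsToeplitzFamily T) (x : Λ.Vertex) :
    star (T (Λ.vertexPath x)) = T (Λ.vertexPath x) :=
  (hT.projection x).isSelfAdjoint.star_eq

theorem vertex_mul_self (hT : Λ.IsToeplitzFamily T) (x : Λ.Vertex) :
    T (Λ.vertexPath x) * T (Λ.vertexPath x) = T (Λ.vertexPath x) :=
  (hT.projection x).isIdempotentElem.eq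

theorem star_mul_self (hT : Λ.IsToeplitzFamily T) (l : Λ.Path) :
    star (T l) * T l = T (Λ.vertexPath l.src) := by
  rw [hT.toeplitz, minExt_self, finsum_mem_singleton, hT.star_vertex, hT.vertex_mul_self]

theorem star_mul_of_ne (hT : Λ.IsToeplitzFamily T) {l m : Λ.Path} (hd : l.d = m.d)
    (hne : l ≠ m) : star (T l) * T m = 0 := by
  rw [hT.toeplitz, minExt_eq_empty hd hne, finsum_mem_empty]

end IsToeplitzFamily

end Families

/-! ### Families of `Λ` and of `Λ \ H` -/

section Remove

variable {H : Set Λ.Vertex} (hH : Λ.IsHereditary H)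

/-- A path with source outside `H`, as a path of `Λ \ H`. -/
def removeLift (l : Λ.Path) (hl : l.src ∉ H) : (Λ.remove H hH).Path :=
  Path.mk (Λ := Λ.remove H hH) (src := ⟨l.src, hl⟩)
    (rng := ⟨l.rng, fun h => hl (hH h ⟨l.hom⟩)⟩) l.hom

/-- The two paths of a minimal extension share their source, so testing the first one decides
whether the pair survives in `Λ \ H`. -/
theorem image_minExt_remove (l m : (Λ.remove H hH).Path) :
    Prod.map (Λ.removeIncl H hH) (Λ.removeIncl H hH) '' (Λ.remove H hH).minExt l m =
      Λ.minExt (Λ.removeIncl H hH l) (Λ.removeIncl H hH m) ∩ {p | p.1.src ∉ H} := by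
  ext ⟨a, b⟩
  constructor
  · rintro ⟨⟨a, b⟩, h, hab⟩
    obtain ⟨rfl, rfl⟩ := Prod.mk.inj hab
    refine ⟨?_, a.src.2⟩
    obtain ⟨l, m, a, b, comm, hdeg⟩ := h
    exact IsMinExt.mk (Λ := Λ) _ _ _ _ comm hdeg
  · rintro ⟨h, ha⟩
    obtain @⟨⟨x, hx⟩, ⟨z, hz⟩, l⟩ := l
    obtain @⟨⟨y, hy⟩, ⟨z', hz'⟩, m⟩ := m
    simp only [removeIncl] at h
    change Λ.IsMinExt _ _ _ _ at h
    dsimp only at h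
    cases h with
    | @mk w _ _ _ l m a b comm hdeg =>
      exact ⟨(removeLift hH ⟨a⟩ ha, removeLift hH ⟨b⟩ ha),
        IsMinExt.mk (Λ := Λ.remove H hH) (w := ⟨w, ha⟩) (x := ⟨x, hx⟩) (y := ⟨y, hy⟩)
          (z := ⟨z, hz⟩) l m a b comm hdeg, rfl⟩

open Classical in
/-- The extension by zero of a family of `Λ \ H`. -/
noncomputable def extendFamily {B : Type*} [Zero B] (S : (Λ.remove H hH).Path → B) (l : Λ.Path) : B :=
  if hl : l.src ∈ H then 0 else S (removeLift hH l hl)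

theorem extendFamily_of_mem {B : Type*} [Zero B] (S : (Λ.remove H hH).Path → B) {l : Λ.Path} (hl : l.src ∈ H) :
    extendFamily hH S l = 0 := dif_pos hl

theorem extendFamily_of_notMem {B : Type*} [Zero B] (S : (Λ.remove H hH).Path → B) {l : Λ.Path} (hl : l.src ∉ H) :
    extendFamily hH S l = S (removeLift hH l hl) := dif_neg hl

theorem extendFamily_removeIncl {B : Type*} [Zero B] (S : (Λ.remove H hH).Path → B) (l : (Λ.remove H hH).Path) :
    extendFamily hH S (Λ.removeIncl H hH l) = S l :=
  extendFamily_of_notMem hH S l.src.2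

theorem finsum_minExt_remove {B : Type*} [AddCommMonoid B] (F : Λ.Path × Λ.Path → B)
    (hF : ∀ p : Λ.Path × Λ.Path, p.1.src ∈ H → F p = 0) (l m : (Λ.remove H hH).Path) :
    ∑ᶠ p ∈ Λ.minExt (Λ.removeIncl H hH l) (Λ.removeIncl H hH m), F p =
      ∑ᶠ p ∈ (Λ.remove H hH).minExt l m, F (Λ.removeIncl H hH p.1, Λ.removeIncl H hH p.2) := by
  have hinj := (Λ.removeIncl_injective H hH).prodMap (Λ.removeIncl_injective H hH)
  have := finsum_mem_image (f := F) (s := (Λ.remove H hH).minExt l m) hinj.injOn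
  rw [image_minExt_remove] at this
  refine Eq.trans ?_ this
  refine finsum_mem_inter_support_eq' _ _ _ fun p hp => ?_
  exact ⟨fun h => ⟨h, fun hs => hp (hF p hs)⟩, fun h => h.1⟩

variable [Λ.IsFinite]

theorem sum_vertex_remove {B : Type*} [AddCommMonoid B] (F : Λ.Vertex → B)
    (hF : ∀ x ∈ H, F x = 0) :
    ∑ x, F x = ∑ x : (Λ.remove H hH).Vertex, F x.1 := by
  refine (Fintype.sum_of_injective (ι := (Λ.remove H hH).Vertex) Subtype.val Subtype.val_injective (fun x => F x.1) F
    (fun x hx => hF x ?_) fun _ => rfl).symm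
  by_contra h
  exact hx ⟨⟨x, h⟩, rfl⟩

variable {B : Type*} [Ring B] [StarRing B]

/-- A Toeplitz-Cuntz-Krieger `Λ`-family that vanishes on `H` restricts to a family of `Λ \ H`. -/
theorem IsUnitalToeplitzFamily.restrict {T : Λ.Path → B} (hT : Λ.IsUnitalToeplitzFamily T)
    (h0 : ∀ x ∈ H, T (Λ.vertexPath x) = 0) :
    (Λ.remove H hH).IsUnitalToeplitzFamily fun l => T (Λ.removeIncl H hH l) where
  partial_isometry l := hT.partial_isometry _
  projection x := hT.projection x.1
  orthogonal x y hxy := hT.orthogonal x.1 y.1 fun h => hxy (Subtype.ext h)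
  mul {w x y} l m := hT.mul (w := w.1) (x := x.1) (y := y.1) l m
  toeplitz l m := by
    rw [hT.toeplitz, finsum_minExt_remove hH (fun p => T p.1 * star (T p.2))]
    intro p hp
    simp only [hT.eq_zero_of_source (h0 _ hp), zero_mul]
  sum_eq_one := by
    rw [← hT.sum_eq_one, sum_vertex_remove hH _ h0]
    rfl

/-- Heredity makes extension by zero consistent: once a path has its source in `H`, so does every
path that prolongs it at the source. Thus if either `l` or `m` is sent to zero, so is every term of
the sum over `Λ.minExt l m`. -/
theorem IsUnitalToeplitzFamily.extend {S : (Λ.remove H hH).Path → B}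
    (hS : (Λ.remove H hH).IsUnitalToeplitzFamily S) :
    Λ.IsUnitalToeplitzFamily (extendFamily hH S) where
  partial_isometry l := by
    by_cases hl : l.src ∈ H
    · simp [extendFamily_of_mem hH S hl]
    · rw [extendFamily_of_notMem hH S hl]
      exact hS.partial_isometry _
  projection x := by
    by_cases hx : x ∈ H
    · rw [extendFamily_of_mem hH S (l := Λ.vertexPath x) hx]
      exact IsStarProjection.zero B
    · rw [extendFamily_of_notMem hH S (l := Λ.vertexPath x) hx]
      exact hS.projection ⟨x, hx⟩
  orthogonal x y hxy := by
    by_cases hx : x ∈ H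
    · rw [extendFamily_of_mem hH S (l := Λ.vertexPath x) hx, zero_mul]
    by_cases hy : y ∈ H
    · rw [extendFamily_of_mem hH S (l := Λ.vertexPath y) hy, mul_zero]
    rw [extendFamily_of_notMem hH S (l := Λ.vertexPath x) hx,
      extendFamily_of_notMem hH S (l := Λ.vertexPath y) hy]
    exact hS.orthogonal ⟨x, hx⟩ ⟨y, hy⟩ fun h => hxy (congrArg Subtype.val h)
  mul {w x y} l m := by
    by_cases hw : w ∈ H
    · rw [extendFamily_of_mem hH S (l := ⟨m⟩) hw, extendFamily_of_mem hH S (l := ⟨m ≫ l⟩) hw,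
        mul_zero]
    have hx : x ∉ H := fun h => hw (hH h ⟨m⟩)
    have hy : y ∉ H := fun h => hx (hH h ⟨l⟩)
    rw [extendFamily_of_notMem hH S (l := ⟨m⟩) hw, extendFamily_of_notMem hH S (l := ⟨l⟩) hx,
      extendFamily_of_notMem hH S (l := ⟨m ≫ l⟩) hw]
    exact hS.mul (w := ⟨w, hw⟩) (x := ⟨x, hx⟩) (y := ⟨y, hy⟩) l m
  toeplitz l m := by
    have hzero : (l.src ∈ H ∨ m.src ∈ H) → ∑ᶠ p ∈ Λ.minExt l m,
        extendFamily hH S p.1 * star (extendFamily hH S p.2) = 0 := by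
      intro hlm
      refine finsum_mem_eq_zero_of_forall_eq_zero fun p hp => ?_
      have hp' : p.1.src ∈ H := by
        obtain ⟨a, b⟩ := p
        change Λ.IsMinExt _ _ _ _ at hp
        obtain ⟨l, m, a, b, -, -⟩ := hp
        rcases hlm with h | h
        exacts [hH h ⟨a⟩, hH h ⟨b⟩]
      rw [extendFamily_of_mem hH S hp', zero_mul]
    by_cases hl : l.src ∈ H
    · rw [hzero (Or.inl hl), extendFamily_of_mem hH S hl, star_zero, zero_mul]
    by_cases hm : m.src ∈ H
    · rw [hzero (Or.inr hm), extendFamily_of_mem hH S hm, mul_zero]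
    rw [extendFamily_of_notMem hH S hl, extendFamily_of_notMem hH S hm, hS.toeplitz]
    refine Eq.trans ?_ (finsum_minExt_remove hH
      (fun p => extendFamily hH S p.1 * star (extendFamily hH S p.2)) (fun p hp => ?_)
      (removeLift hH l hl) (removeLift hH m hm)).symm
    · simp only [extendFamily_removeIncl]
    · simp only [extendFamily_of_mem hH S hp, zero_mul]
  sum_eq_one := by
    rw [sum_vertex_remove hH _ fun x hx => extendFamily_of_mem hH S (l := Λ.vertexPath x) hx,
      ← hS.sum_eq_one]
    exact Finset.sum_congr rfl fun x _ =>
      extendFamily_removeIncl hH S ((Λ.remove H hH).vertexPath x)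

end Remove

theorem IsUnitalToeplitzFamily.map [Λ.IsFinite] {A B : Type*} [CStarAlgebra A] [CStarAlgebra B]
    {T : Λ.Path → A} (hT : Λ.IsUnitalToeplitzFamily T) (q : A →⋆ₐ[ℂ] B) :
    Λ.IsUnitalToeplitzFamily fun l => q (T l) where
  partial_isometry l := by rw [← map_star, ← map_mul, ← map_mul, hT.partial_isometry]
  projection x := (hT.projection x).map q
  orthogonal x y hxy := by rw [← map_mul, hT.orthogonal x y hxy, map_zero]
  mul l m := by rw [← map_mul, hT.mul]
  toeplitz l m := by
    rw [← map_star, ← map_mul, hT.toeplitz,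
      finsum_mem_eq_finite_toFinset_sum _ (Λ.minExt_finite l m),
      finsum_mem_eq_finite_toFinset_sum _ (Λ.minExt_finite l m), map_sum]
    simp only [map_mul, map_star]
  sum_eq_one := by rw [← map_sum, hT.sum_eq_one, map_one]

/-! ### Density in the Toeplitz algebra and the quotient by `H` -/

namespace ToeplitzAlgebra

variable [Λ.IsFinite]

theorem hom_ext {B : Type*} [CStarAlgebra B] {f g : Λ.ToeplitzAlgebra →⋆ₐ[ℂ] B}
    (h : ∀ l, f (t l) = g (t l)) (a : Λ.ToeplitzAlgebra) : f a = g a := by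
  induction a using ToeplitzAlgebra.induction_on with
  | hc => exact isClosed_eq (continuous_starAlgHom f) (continuous_starAlgHom g)
  | ih x =>
  induction x using FreeStarAlg.induction with
  | scalar c => rw [AlgHom.commutes, AlgHomClass.commutes, AlgHomClass.commutes]
  | gen a =>
    obtain ⟨l, b⟩ := a
    cases b
    · exact h l
    · rw [← star_t, map_star, map_star, h]
  | add x y hx hy => rw [map_add, map_add, map_add, hx, hy]
  | mul x y hx hy => rw [map_mul, map_mul, map_mul, hx, hy]

/-- A multiplicatively closed set that contains the scalars, the generators and their adjoints has
dense span. -/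
theorem dense_span {T : Set Λ.ToeplitzAlgebra} (hscalar : ∀ z : ℂ, algebraMap ℂ _ z ∈ T)
    (ht : ∀ l, t l ∈ T) (hstar : ∀ l, star (t l) ∈ T) (hmul : ∀ a ∈ T, ∀ b ∈ T, a * b ∈ T) :
    Dense (Submodule.span ℂ T : Set Λ.ToeplitzAlgebra) := by
  refine denseRange_of.mono ?_
  rintro _ ⟨x, rfl⟩
  induction x using FreeStarAlg.induction with
  | scalar c =>
    rw [AlgHom.commutes]
    exact Submodule.subset_span (hscalar c)
  | gen a =>
    obtain ⟨l, b⟩ := a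
    cases b
    · exact Submodule.subset_span (ht l)
    · rw [← star_t]
      exact Submodule.subset_span (hstar l)
  | add x y hx hy =>
    rw [map_add]
    exact add_mem hx hy
  | mul x y hx hy =>
    rw [map_mul]
    have h := Submodule.mul_mem_mul hx hy
    rw [Submodule.span_mul_span] at h
    refine Submodule.span_mono ?_ h
    rintro _ ⟨a, ha, b, hb, rfl⟩
    exact hmul a ha b hb

theorem isHomogeneous_t (r : Fin k → ℝ) (l : Λ.Path) :
    IsHomogeneous (dynamics r) (∑ i, r i * l.d i) (t l) := fun s => by
  refine (lift_t _ _ l).trans ?_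
  congr 1
  simp only [torusPow, Circle.coe_exp, ← Complex.exp_nat_mul, ← Complex.exp_sum]
  congr 1
  push_cast
  rw [Finset.mul_sum]
  exact Finset.sum_congr rfl fun i _ => by ring

theorem dense_span_isHomogeneous (r : Fin k → ℝ) :
    Dense (Submodule.span ℂ {a : Λ.ToeplitzAlgebra | ∃ c, IsHomogeneous (dynamics r) c a} :
      Set Λ.ToeplitzAlgebra) :=
  dense_span (fun z => ⟨0, isHomogeneous_algebraMap z⟩) (fun l => ⟨_, isHomogeneous_t r l⟩)
    (fun l => ⟨_, (isHomogeneous_t r l).star⟩) fun _ ⟨_, ha⟩ _ ⟨_, hb⟩ => ⟨_, ha.mul hb⟩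

section Quotient

variable {H : Set Λ.Vertex} (hH : Λ.IsHereditary H)

/-- The quotient map `𝒯C*(Λ) → 𝒯C*(Λ \ H)` that kills the paths with source in `H`. -/
noncomputable def removeHom : Λ.ToeplitzAlgebra →⋆ₐ[ℂ] (Λ.remove H hH).ToeplitzAlgebra :=
  lift _ (isUnitalToeplitzFamily_t (Λ := Λ.remove H hH)).extend

theorem removeHom_of_mem {l : Λ.Path} (hl : l.src ∈ H) : removeHom hH (t l) = 0 :=
  (lift_t _ _ l).trans (extendFamily_of_mem hH _ hl)

theorem removeHom_removeIncl (l : (Λ.remove H hH).Path) :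
    removeHom hH (t (Λ.removeIncl H hH l)) = t l :=
  (lift_t _ _ _).trans (extendFamily_removeIncl hH _ l)

theorem removeHom_dynamics (r : Fin k → ℝ) (s : ℝ) (a : Λ.ToeplitzAlgebra) :
    removeHom hH (dynamics r s a) = dynamics r s (removeHom hH a) := by
  refine hom_ext (f := (removeHom hH).comp (dynamics r s))
    (g := (dynamics r s).comp (removeHom hH)) (fun l => ?_) a
  change removeHom hH (dynamics r s (t l)) = dynamics r s (removeHom hH (t l))
  rw [isHomogeneous_t, map_smul]
  by_cases hl : l.src ∈ H
  · rw [removeHom_of_mem hH hl, map_zero, smul_zero]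
  · have h : removeHom hH (t l) = t (removeLift hH l hl) :=
      removeHom_removeIncl hH (removeLift hH l hl)
    rw [h, isHomogeneous_t]
    rfl

/-- The images of the homogeneous elements have dense span. -/
theorem dense_span_image_isHomogeneous (r : Fin k → ℝ) :
    Dense (Submodule.span ℂ (removeHom hH '' {a | ∃ c, IsHomogeneous (dynamics r) c a}) :
      Set (Λ.remove H hH).ToeplitzAlgebra) := by
  refine dense_span (fun z => ?_) (fun l => ?_) (fun l => ?_) ?_
  · exact ⟨_, ⟨0, isHomogeneous_algebraMap z⟩, AlgHomClass.commutes _ _⟩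
  · exact ⟨_, ⟨_, isHomogeneous_t r _⟩, removeHom_removeIncl hH l⟩
  · exact ⟨_, ⟨_, (isHomogeneous_t r (Λ.removeIncl H hH l)).star⟩, by
      rw [map_star, removeHom_removeIncl]⟩
  · rintro _ ⟨a, ⟨c, ha⟩, rfl⟩ _ ⟨b, ⟨d, hb⟩, rfl⟩
    exact ⟨a * b, ⟨_, ha.mul hb⟩, map_mul _ _ _⟩

open scoped InnerProductSpace in
/-- A state whose GNS representation kills the vertex projections of `H` factors through
`𝒯C*(Λ \ H)`. -/
theorem exists_isState_comp_removeHom {φ : Λ.ToeplitzAlgebra →ₗ[ℂ] ℂ} (hφ : IsState φ)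
    (h0 : ∀ x ∈ H, ∀ a, φ (star a * t (Λ.vertexPath x) * a) = 0) :
    ∃ ψ : (Λ.remove H hH).ToeplitzAlgebra →ₗ[ℂ] ℂ, IsState ψ ∧
      ∀ a, φ a = ψ (removeHom hH a) := by
  let _ := CStarAlgebra.spectralOrder Λ.ToeplitzAlgebra
  have := CStarAlgebra.spectralOrderedRing Λ.ToeplitzAlgebra
  let f := hφ.toPositiveLinearMap
  have hf : ∀ a, f a = φ a := fun _ => rfl
  let π := f.gnsStarAlgHom
  have hπ : ∀ a b : Λ.ToeplitzAlgebra, π a (f.toPreGNS b : f.GNS) = (f.toPreGNS (a * b) : f.GNS) :=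
    fun a b => f.gnsNonUnitalStarAlgHom_apply_coe
  -- On the dense image of the algebra, `‖π(q_x) b‖² = φ(b* q_x b)`, which vanishes by assumption.
  have hπ0 : ∀ x ∈ H, π (t (Λ.vertexPath x)) = 0 := by
    intro x hx
    ext b
    induction b using UniformSpace.Completion.induction_on with
    | hp => exact isClosed_eq (by fun_prop) (by fun_prop)
    | ih b =>
    have hq := (isUnitalToeplitzFamily_t (Λ := Λ)).toIsToeplitzFamily
    have h1 := hπ (t (Λ.vertexPath x)) (f.ofPreGNS b)
    rw [f.toPreGNS_ofPreGNS] at h1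
    rw [h1, zero_apply, ← norm_eq_zero, UniformSpace.Completion.norm_coe, ← sq_eq_zero_iff,
      ← Complex.ofReal_eq_zero, Complex.ofReal_pow, f.preGNS_norm_sq, f.ofPreGNS_toPreGNS, hf,
      star_mul, hq.star_vertex, mul_assoc, ← mul_assoc (t _), hq.vertex_mul_self, ← mul_assoc]
    exact h0 x hx _
  have hT : Λ.IsUnitalToeplitzFamily fun l => π (t l) :=
    (isUnitalToeplitzFamily_t (Λ := Λ)).map π
  -- The kernel of `removeHom` need not be computed: the universal property of the target gives `ρ`
  -- with `ρ ∘ removeHom = π`, and `ψ` is the vector state of `ρ` at the class `ξ` of `1`.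
  let ρ := lift _ (hT.restrict hH hπ0)
  have hρ : ∀ a, ρ (removeHom hH a) = π a := by
    refine hom_ext (f := ρ.comp (removeHom hH)) fun l => ?_
    change ρ (removeHom hH (t l)) = π (t l)
    by_cases hl : l.src ∈ H
    · rw [removeHom_of_mem hH hl, map_zero]
      exact (hT.eq_zero_of_source (hπ0 _ hl)).symm
    · have h : removeHom hH (t l) = t (removeLift hH l hl) :=
        removeHom_removeIncl hH (removeLift hH l hl)
      rw [h]
      exact lift_t _ _ _
  let ξ : f.GNS := (f.toPreGNS 1 : f.GNS)
  have hφρ : ∀ a, φ a = ⟪ξ, ρ (removeHom hH a) ξ⟫_ℂ := by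
    intro a
    rw [hρ, hπ, UniformSpace.Completion.inner_coe, f.preGNS_inner_def, f.ofPreGNS_toPreGNS,
      f.ofPreGNS_toPreGNS, star_one, one_mul, mul_one, hf]
  refine ⟨{ toFun := fun b => ⟪ξ, ρ b ξ⟫_ℂ
            map_add' := fun a b => by rw [map_add, add_apply, inner_add_right]
            map_smul' := fun c a => by
              rw [map_smul, smul_apply, inner_smul_right]; rfl }, ⟨?_, ?_⟩, hφρ⟩
  · intro b
    change 0 ≤ ⟪ξ, ρ (star b * b) ξ⟫_ℂ
    rw [map_mul, map_star, mul_apply_eq_comp, ContinuousLinearMap.star_eq_adjoint,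
      ContinuousLinearMap.adjoint_inner_right, inner_self_eq_norm_sq_to_K]
    change (0 : ℂ) ≤ (‖ρ b ξ‖ : ℂ) ^ 2
    rw [← Complex.ofReal_pow]
    exact Complex.zero_le_real.2 (sq_nonneg _)
  · change ⟪ξ, ρ 1 ξ⟫_ℂ = 1
    rw [← map_one (removeHom hH), ← hφρ, hφ.map_one]

end Quotient

end ToeplitzAlgebra

variable {k : ℕ} {Λ : HigherRankGraph.{u, v} k} [Λ.IsFinite]

namespace ToeplitzAlgebra

/-! ### Weights of vertices under a KMS state -/

section Weights

variable (Λ) in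
/-- The finite set of paths of degree `n` with range `x`. -/
noncomputable def pathsInto (n : Fin k → ℕ) (x : Λ.Vertex) : Finset Λ.Path :=
  ((IsFinite.finite_paths (Λ := Λ) n).subset
    (t := {p : Λ.Path | p.d = n ∧ p.rng = x}) fun _ h => h.1).toFinset

theorem mem_pathsInto {n : Fin k → ℕ} {x : Λ.Vertex} {p : Λ.Path} :
    p ∈ pathsInto Λ n x ↔ p.d = n ∧ p.rng = x := by
  simp [pathsInto]

/-- The value of a functional at the vertex projection `q_x`. -/
noncomputable def weight (φ : Λ.ToeplitzAlgebra →ₗ[ℂ] ℂ) (x : Λ.Vertex) : ℝ :=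
  (φ (t (Λ.vertexPath x))).re

theorem apply_vertex_nonneg {φ : Λ.ToeplitzAlgebra →ₗ[ℂ] ℂ} (hφ : IsState φ) (x : Λ.Vertex) :
    0 ≤ φ (t (Λ.vertexPath x)) := by
  have hq := (isUnitalToeplitzFamily_t (Λ := Λ)).toIsToeplitzFamily
  have := hφ.nonneg (t (Λ.vertexPath x))
  rwa [hq.star_vertex, hq.vertex_mul_self] at this

theorem weight_nonneg {φ : Λ.ToeplitzAlgebra →ₗ[ℂ] ℂ} (hφ : IsState φ) (x : Λ.Vertex) :
    0 ≤ weight φ x := (Complex.le_def.1 (apply_vertex_nonneg hφ x)).1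

theorem ofReal_weight {φ : Λ.ToeplitzAlgebra →ₗ[ℂ] ℂ} (hφ : IsState φ) (x : Λ.Vertex) :
    (weight φ x : ℂ) = φ (t (Λ.vertexPath x)) :=
  Complex.ext rfl (Complex.le_def.1 (apply_vertex_nonneg hφ x)).2

variable {r : Fin k → ℝ} {φ : Λ.ToeplitzAlgebra →ₗ[ℂ] ℂ}

theorem apply_mul_star (hφ : IsKMSState (dynamics r) 1 φ) (p : Λ.Path) :
    φ (t p * star (t p)) = Real.exp (-∑ i, r i * p.d i) * weight φ p.src := by
  have hq := (isUnitalToeplitzFamily_t (Λ := Λ)).toIsToeplitzFamily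
  rw [hφ.apply_mul_of_isHomogeneous (dense_span_isHomogeneous r) (isHomogeneous_t r p),
    hq.star_mul_self, ofReal_weight hφ.toIsState, Complex.ofReal_exp, Complex.ofReal_neg]

/-- The subinvariance relation: the weights of the paths of degree `n` into `x` add up to at most
the weight of `x`. -/
theorem sum_weight_le (hφ : IsKMSState (dynamics r) 1 φ) (n : Fin k → ℕ) (x : Λ.Vertex) :
    ∑ p ∈ pathsInto Λ n x, weight φ p.src ≤ Real.exp (∑ i, r i * n i) * weight φ x := by
  have hq := (isUnitalToeplitzFamily_t (Λ := Λ)).toIsToeplitzFamily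
  set Q := t (Λ.vertexPath x) with hQ
  -- `P` is a projection below `Q = q_x`, by orthogonality of range projections of equal degree. So
  -- `Q - P = (Q - P)*(Q - P)` has nonnegative value.
  set P := ∑ p ∈ pathsInto Λ n x, t p * star (t p) with hP
  have hQs : star Q = Q := hq.star_vertex x
  have hQQ : Q * Q = Q := hq.vertex_mul_self x
  have hPs : star P = P := by
    rw [hP, star_sum]
    exact Finset.sum_congr rfl fun p _ => by rw [star_mul, star_star]
  have hQP : Q * P = P := by
    rw [hP, Finset.mul_sum]
    refine Finset.sum_congr rfl fun p hp => ?_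
    obtain ⟨-, rfl⟩ := mem_pathsInto.1 hp
    rw [← mul_assoc, hq.range_mul]
  have hPQ : P * Q = P := by
    have := congrArg star hQP
    rwa [star_mul, hPs, hQs] at this
  have hPP : P * P = P := by
    nth_rewrite 1 [hP]
    rw [Finset.sum_mul]
    refine Finset.sum_congr rfl fun p hp => ?_
    rw [hP, Finset.mul_sum, Finset.sum_eq_single p]
    · rw [mul_assoc, ← mul_assoc (star (t p)), ← mul_assoc, ← mul_assoc, hq.partial_isometry]
    · intro p' hp' hne
      rw [mul_assoc, ← mul_assoc (star (t p)), hq.star_mul_of_ne _ hne.symm, zero_mul, mul_zero]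
      rw [(mem_pathsInto.1 hp).1, (mem_pathsInto.1 hp').1]
    · exact fun h => absurd hp h
  have hpos := hφ.nonneg (Q - P)
  rw [star_sub, hQs, hPs, sub_mul, mul_sub, mul_sub, hQQ, hQP, hPQ, hPP, sub_self, sub_zero,
    map_sub, sub_nonneg, hP, map_sum] at hpos
  have h1 : ∑ p ∈ pathsInto Λ n x, φ (t p * star (t p)) =
      ((Real.exp (-∑ i, r i * n i) * ∑ p ∈ pathsInto Λ n x, weight φ p.src : ℝ) : ℂ) := by
    rw [Finset.mul_sum, Complex.ofReal_sum]
    refine Finset.sum_congr rfl fun p hp => ?_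
    rw [apply_mul_star hφ, (mem_pathsInto.1 hp).1, Complex.ofReal_mul]
  rw [h1, hQ, ← ofReal_weight hφ.toIsState, Complex.real_le_real, Real.exp_neg,
    inv_mul_le_iff₀ (Real.exp_pos _)] at hpos
  exact hpos

/-- The weight of `w` is one term of a nonnegative sum bounded by a multiple of the weight of `x`.
-/
theorem weight_eq_zero_of_hom (hφ : IsKMSState (dynamics r) 1 φ) {w x : Λ.Vertex}
    (hf : Nonempty (w ⟶ x)) (hx : weight φ x = 0) : weight φ w = 0 := by
  obtain ⟨f⟩ := hf
  refine le_antisymm ?_ (weight_nonneg hφ.toIsState w)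
  have h1 := sum_weight_le hφ (Λ.deg f) x
  rw [hx, mul_zero] at h1
  exact (Finset.single_le_sum (f := fun p : Λ.Path => weight φ p.src)
    (fun p _ => weight_nonneg hφ.toIsState p.src)
    (mem_pathsInto.2 ⟨rfl, rfl⟩ : (Path.mk f : Λ.Path) ∈ pathsInto Λ (Λ.deg f) x)).trans h1

open Classical in
theorem sum_vertexMatrix (j : Fin k) (x : Λ.Vertex) (m : Λ.Vertex → ℝ) :
    ∑ w, (Λ.vertexMatrix j x w : ℝ) * m w = ∑ p ∈ pathsInto Λ (Pi.single j 1) x, m p.src := by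
  rw [← Finset.sum_fiberwise (pathsInto Λ (Pi.single j 1) x) Path.src]
  refine Finset.sum_congr rfl fun w _ => ?_
  have hcard : Λ.vertexMatrix j x w =
      ((pathsInto Λ (Pi.single j 1) x).filter fun p => p.src = w).card := by
    rw [vertexMatrix, ← Fintype.card_coe, ← Nat.card_eq_fintype_card]
    refine Nat.card_eq_of_bijective (fun f => ⟨⟨f.1⟩, Finset.mem_filter.2
      ⟨mem_pathsInto.2 ⟨f.2, rfl⟩, rfl⟩⟩) ⟨?_, ?_⟩
    · rintro ⟨f, hf⟩ ⟨g, hg⟩ h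
      have := congrArg Subtype.val h
      simp only [Path.mk.injEq, heq_eq_eq, true_and] at this
      exact Subtype.ext this
    · rintro ⟨⟨f⟩, hp⟩
      obtain ⟨hmem, rfl⟩ := Finset.mem_filter.1 hp
      obtain ⟨hd, rfl⟩ := mem_pathsInto.1 hmem
      exact ⟨⟨f, hd⟩, rfl⟩
  rw [hcard, Finset.sum_congr rfl fun p hp => by rw [(Finset.mem_filter.1 hp).2],
    Finset.sum_const, nsmul_eq_mul]

theorem sum_vertexMatrix_weight_le (hφ : IsKMSState (dynamics r) 1 φ) (j : Fin k)
    (x : Λ.Vertex) :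
    ∑ w, (Λ.vertexMatrix j x w : ℝ) * weight φ w ≤ Real.exp (r j) * weight φ x := by
  rw [sum_vertexMatrix]
  refine (sum_weight_le hφ _ x).trans_eq ?_
  congr 2
  rw [Finset.sum_eq_single j (fun i _ hi => by simp [hi]) (by simp)]
  simp

/-- The sources of the edges of a critical colour that leave a critical component have weight
zero. -/
theorem weight_eq_zero_of_exit_edge (hφ : IsKMSState (dynamics r) 1 φ) {C : Set Λ.Vertex}
    {j : Fin k} (hrj : 0 < r j)
    (hC : haveI := Λ.finite_vertex; r j = Real.log (specRad (Λ.blockMatrix C j)))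
    (hirr : haveI := Λ.finite_vertex; IrreducibleMatrix (Λ.blockMatrix C j))
    {a b : Λ.Vertex} (e : b ⟶ a) (he : Λ.deg e = Pi.single j 1) (ha : a ∈ C) (hb : b ∉ C) :
    weight φ b = 0 := by
  classical
  have := Λ.finite_vertex
  have := Fintype.ofFinite C
  -- `r_j > 0` excludes spectral radius zero, where `Real.log 0 = 0`.
  have hρ : specRad (Λ.blockMatrix C j) = Real.exp (r j) := by
    rw [hC, Real.exp_log]
    refine (specRad_nonneg _).lt_of_ne fun h0 => ?_
    rw [← h0, Real.log_zero] at hC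
    exact hrj.ne' hC
  have hnn : ∀ x w, 0 ≤ (Λ.vertexMatrix j x w : ℝ) * weight φ w := fun x w =>
    mul_nonneg (Nat.cast_nonneg _) (weight_nonneg hφ.toIsState w)
  have hsplit : ∀ x, ∑ w, (Λ.vertexMatrix j x w : ℝ) * weight φ w =
      ∑ w : C, (Λ.vertexMatrix j x w : ℝ) * weight φ w +
        ∑ w : {w // w ∉ C}, (Λ.vertexMatrix j x w : ℝ) * weight φ w := fun x => by
    convert (Fintype.sum_subtype_add_sum_subtype (· ∈ C)
      fun w => (Λ.vertexMatrix j x w : ℝ) * weight φ w).symm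
  have hle : ∀ x : C, ∑ w : C, (Λ.blockMatrix C j x w : ℝ) * weight φ w ≤
      specRad (Λ.blockMatrix C j) * weight φ x := fun x => by
    rw [hρ]
    refine le_trans ?_ (sum_vertexMatrix_weight_le hφ j x)
    rw [hsplit]
    exact le_add_of_nonneg_right (Finset.sum_nonneg fun w _ => hnn _ _)
  -- Inside `C` the bound `e^{r_j} m_a` is already attained, so the terms of row `a` outside `C`
  -- must vanish.
  have heq := hirr.mulVec_eq (fun x : C => weight φ x) (fun x => weight_nonneg hφ.toIsState x)
    hle ⟨a, ha⟩
  have htot := sum_vertexMatrix_weight_le hφ j a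
  rw [hsplit, ← hρ] at htot
  have h0 : (Λ.vertexMatrix j a b : ℝ) * weight φ b ≤ 0 := by
    refine (Finset.single_le_sum
      (f := fun w : {w // w ∉ C} => (Λ.vertexMatrix j a w : ℝ) * weight φ w)
      (fun w _ => hnn a w) (Finset.mem_univ (⟨b, hb⟩ : {w // w ∉ C}))).trans ?_
    have heq' : ∑ w : C, (Λ.vertexMatrix j a w : ℝ) * weight φ w =
      specRad (Λ.blockMatrix C j) * weight φ a := heq
    rw [heq'] at htot
    linarith
  have hedge : 0 < (Λ.vertexMatrix j a b : ℝ) := by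
    have hfin : Finite {f : b ⟶ a // Λ.deg f = Pi.single j 1} := by
      have := (IsFinite.finite_paths (Λ := Λ) (Pi.single j 1)).to_subtype
      refine Finite.of_injective (fun f => (⟨⟨f.1⟩, f.2⟩ :
        {p : Λ.Path | p.d = Pi.single j 1})) fun f g h => ?_
      have := congrArg Subtype.val h
      simp only [Path.mk.injEq, heq_eq_eq, true_and] at this
      exact Subtype.ext this
    have : Nonempty {f : b ⟶ a // Λ.deg f = Pi.single j 1} := ⟨⟨e, he⟩⟩
    exact Nat.cast_pos.2 Nat.card_pos
  nlinarith [weight_nonneg hφ.toIsState b]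

/-- KMS states vanish on the vertex projections of the redundant set. -/
theorem weight_eq_zero_of_mem_redundantSet (hφ : IsKMSState (dynamics r) 1 φ)
    (hr : ∀ i, 0 < r i) (hcover : ⋃₀ Λ.components = Set.univ)
    (hconn : ∀ C ∈ Λ.components, ∀ D ∈ Λ.components,
      (∃ j, Λ.ColourConnected j C D) → ∀ i, Λ.ColourConnected i C D)
    {x : Λ.Vertex} (hx : x ∈ Λ.redundantSet r) : weight φ x = 0 := by
  obtain ⟨⟨C, hC, c, hc, ⟨f⟩⟩, hxC⟩ := mem_redundantSet_iff.1 hx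
  obtain ⟨hCc, j, -, hCj, hirr⟩ := hC.1
  obtain ⟨i, a, b, e, -, ha, hb, he, hxb⟩ := exists_exit_edge f hc (hxC C hC)
  obtain ⟨D, hD, hbD⟩ : b ∈ ⋃₀ Λ.components := hcover ▸ Set.mem_univ b
  -- The exit edge `e` may have the wrong colour `i`. As a path of degree `1 • e_i` from `C` to `D`,
  -- it yields a path `g` from `C` to `D` in the critical colour `j`.
  obtain ⟨y, hy, w, hw, g, n, hg⟩ :=
    hconn C hCc D hD ⟨i, a, ha, b, hbD, e, 1, by rw [he, one_smul]⟩ j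
  have hwC : w ∉ C := fun h => hb (component_eq_component hCc hD h hw ▸ hbD)
  obtain ⟨i', a', b', e', hi', ha', hb', he', hwb'⟩ := exists_exit_edge g hy hwC
  -- The exit edge of `g` uses a colour that occurs in `g`, whose degree is a multiple of `e_j`.
  obtain rfl : i' = j := by
    by_contra hne
    rw [hg] at hi'
    simp [hne] at hi'
  have h1 := weight_eq_zero_of_exit_edge hφ (hr _) hCj hirr e' he' ha' hb'
  -- The zero propagates along `b' → w → b → x`, with `w` and `b` both in `D`.
  have h2 := weight_eq_zero_of_hom hφ hwb' h1
  have h3 := weight_eq_zero_of_hom hφ (nonempty_hom_of_mem_component hD hw hbD) h2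
  exact weight_eq_zero_of_hom hφ hxb h3

/-- A KMS state with zero weight on a hereditary set `H` factors through a KMS state of
`𝒯C*(Λ \ H)`. -/
theorem exists_isKMSState_comp_removeHom {H : Set Λ.Vertex} (hH : Λ.IsHereditary H)
    (hφ : IsKMSState (dynamics r) 1 φ) (h0 : ∀ x ∈ H, weight φ x = 0) :
    ∃ ψ : (Λ.remove H hH).ToeplitzAlgebra →ₗ[ℂ] ℂ, IsKMSState (dynamics r) 1 ψ ∧
      ∀ a, φ a = ψ (removeHom hH a) := by
  have hq := (isUnitalToeplitzFamily_t (Λ := Λ)).toIsToeplitzFamily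
  obtain ⟨ψ, hψ, hφψ⟩ := exists_isState_comp_removeHom hH hφ.toIsState fun x hx a => by
    refine hφ.apply_mul_mul_eq_zero (dense_span_isHomogeneous r) ?_ _ _
    rw [hq.star_vertex, hq.vertex_mul_self, ← ofReal_weight hφ.toIsState, h0 x hx,
      Complex.ofReal_zero]
  refine ⟨ψ, IsKMSState.of_isHomogeneous hψ (dense_span_image_isHomogeneous hH r) ?_, hφψ⟩
  rintro _ ⟨a, ⟨c, ha⟩, rfl⟩
  refine ⟨c, ha.map (removeHom_dynamics hH r), ?_⟩
  have hc := hψ.continuous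
  -- Since `φ = ψ ∘ removeHom`, the commutation rule for `ψ` is known only against elements in the
  -- image; density removes this restriction.
  refine linearMap_ext_of_dense_span (f := ψ ∘ₗ LinearMap.mulLeft ℂ (removeHom hH a))
    (g := Complex.exp (-c) • (ψ ∘ₗ LinearMap.mulRight ℂ (removeHom hH a)))
    (dense_span_image_isHomogeneous hH r) (hc.comp (continuous_const_mul _))
    ((hc.comp (continuous_mul_const _)).const_smul _) ?_
  rintro _ ⟨b, -, rfl⟩
  change ψ (removeHom hH a * removeHom hH b) =
    Complex.exp (-c) • ψ (removeHom hH b * removeHom hH a)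
  rw [← map_mul, ← map_mul, ← hφψ, ← hφψ]
  exact hφ.apply_mul_of_isHomogeneous (dense_span_isHomogeneous r) ha b

end Weights

end ToeplitzAlgebra

end HigherRankGraph


theorem mainTheorem7 {k : ℕ} (Λ : HigherRankGraph.{u, v} k) [Λ.IsFinite]
    (hΛ : Λ.NoSourcesOrSinks)
    (r : Fin k → ℝ) (hr : ∀ i, 0 < r i) (hnorm : Λ.Normalised r)
    (hcover : ⋃₀ Λ.components = Set.univ)
    (hirr : ∀ C ∈ Λ.components, Λ.CoordinatewiseIrreducible C)
    (hconn : ∀ C ∈ Λ.components, ∀ D ∈ Λ.components,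
      (∃ j, Λ.ColourConnected j C D) → ∀ i, Λ.ColourConnected i C D) :
    ∃ hH : Λ.IsHereditary (Λ.redundantSet r),
      (fun D : Set {x : Λ.Vertex // x ∉ Λ.redundantSet r} => Subtype.val '' D) ''
          (Λ.remove (Λ.redundantSet r) hH).critical r = Λ.minCritical r ∧
      (∀ C ∈ Λ.minCritical r,
        (Λ.remove (Λ.redundantSet r) hH).IsHereditary
          {x : {x : Λ.Vertex // x ∉ Λ.redundantSet r} | x.1 ∈ C}) ∧
      ∃ q : Λ.ToeplitzAlgebra →⋆ₐ[ℂ] (Λ.remove (Λ.redundantSet r) hH).ToeplitzAlgebra,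
        (∀ l : Λ.Path, l.src ∈ Λ.redundantSet r → q (HigherRankGraph.ToeplitzAlgebra.t l) = 0) ∧
        (∀ l : (Λ.remove (Λ.redundantSet r) hH).Path,
          q (HigherRankGraph.ToeplitzAlgebra.t (Λ.removeIncl _ hH l)) = HigherRankGraph.ToeplitzAlgebra.t l) ∧
        ∀ φ : Λ.ToeplitzAlgebra →ₗ[ℂ] ℂ,
          HigherRankGraph.IsKMSState (HigherRankGraph.ToeplitzAlgebra.dynamics r) 1 φ →
          ∃ ψ : (Λ.remove (Λ.redundantSet r) hH).ToeplitzAlgebra →ₗ[ℂ] ℂ,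
            HigherRankGraph.IsKMSState (HigherRankGraph.ToeplitzAlgebra.dynamics r) 1 ψ ∧
            ∀ a, φ a = ψ (q a) := by

  exact ⟨HigherRankGraph.isHereditary_redundantSet Λ r,
    HigherRankGraph.critical_remove_redundantSet hr hnorm _,
    fun C hC => HigherRankGraph.isHereditary_minCritical_remove hC _,
    HigherRankGraph.ToeplitzAlgebra.removeHom _,
    fun l hl => HigherRankGraph.ToeplitzAlgebra.removeHom_of_mem _ hl,
    fun l => HigherRankGraph.ToeplitzAlgebra.removeHom_removeIncl _ l,
    fun φ hφ => HigherRankGraph.ToeplitzAlgebra.exists_isKMSState_comp_removeHom _ hφ fun x hx =>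
      HigherRankGraph.ToeplitzAlgebra.weight_eq_zero_of_mem_redundantSet hφ hr hcover hconn hx⟩
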